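/- Let $\mu$ be a probability measure on $[0,\infty)$ whose tail is regularly varying of index $-\alpha$ for some $\alpha\ge 0$, i.e. for every $t>0$, $$\frac{\mu(tx,\infty)}{\mu(x,\infty)}\to t^{-\alpha}\qquad (x\to\infty).$$ Then $\mu$ is Boolean-subexponential: $\mu(y,\infty)>0$ for all $y\ge 0$, and for every integer $n\ge 1$ the $n$-fold additive Boolean convolution $\mu^{\uplus n}=\mu\uplus\cdots\uplus\mu$ exists and satisfies $$\mu^{\uplus n}(y,\infty)\sim n\,\mu(y,\infty)\qquad (y\to\infty).$$ Here, for a probability measure $\mu$ on $\mathbb R$ and $z$ in the open upper half-plane $\mathbb C^+$, put $G_\mu(z)=\int_{\mathbb R}\frac{1}{z-t}\,d\mu(t)$ and $K_\mu(z)=z-\frac1{G_\mu(z)}$; the additive Boolean convolution $\mu\uplus\nu$ of probability measures $\mu,\nu$ on $\mathbb R$ is the probability measure on $\mathbb R$ determined by $K_{\mu\uplus\nu}(z)=K_\mu(z)+K_\nu(z)$ for all $z\in\mathbb C^+$. The notation $f(y)\sim g(y)$ means $f(y)/g(y)\to 1$. -/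

import Mathlib

open MeasureTheory Filter Topology Set Asymptotics

noncomputable section

/-- The Cauchy transform `G_μ(z) = ∫ 1 / (z - t) dμ(t)` of a probability measure on the line;
it is used for `z` in the open upper half-plane only. -/
def cauchyTransform (μ : ProbabilityMeasure ℝ) (z : ℂ) : ℂ :=
  ∫ t : ℝ, 1 / (z - (t : ℂ)) ∂(μ : Measure ℝ)

/-- The transform `K_μ(z) = z - 1 / G_μ(z)`; it is used for `z` in the open upper half-plane only
(there `G_μ(z) ≠ 0`, its imaginary part being negative). -/
def booleanK (μ : ProbabilityMeasure ℝ) (z : ℂ) : ℂ :=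
  z - 1 / cauchyTransform μ z

/-- `IsBooleanConv μ ν ρ` says that `ρ` is the additive Boolean convolution `μ ⊎ ν`: the
probability measure determined by `K_ρ = K_μ + K_ν` on the open upper half-plane. -/
def IsBooleanConv (μ ν ρ : ProbabilityMeasure ℝ) : Prop :=
  ∀ z : ℂ, 0 < z.im → booleanK ρ z = booleanK μ z + booleanK ν z

/-- `IsBooleanPower μ n ρ` says that `ρ` is the `n`-fold additive Boolean convolution
`μ ⊎ ⋯ ⊎ μ`, for `n ≥ 1`. -/
inductive IsBooleanPower (μ : ProbabilityMeasure ℝ) : ℕ → ProbabilityMeasure ℝ → Prop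
  | one : IsBooleanPower μ 1 μ
  | succ {n : ℕ} {σ ρ : ProbabilityMeasure ℝ} :
      IsBooleanPower μ n σ → IsBooleanConv σ μ ρ → IsBooleanPower μ (n + 1) ρ

/-- The tail `y ↦ μ(y, ∞)`. -/
def measureTail (μ : ProbabilityMeasure ℝ) (y : ℝ) : ℝ :=
  (μ : Measure ℝ).real (Ioi y)

/-- `μ` is concentrated on `[0, ∞)`. -/
def SupportedOnNonneg (μ : ProbabilityMeasure ℝ) : Prop :=
  (μ : Measure ℝ) (Iio 0) = 0

/-- A function, measurable on `[0, ∞)`, is regularly varying at infinity of index `β` if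
`f (t x) / f x → t ^ β` as `x → ∞`, for every `t > 0`. (The case `t = 1` forces `f x ≠ 0` for all
large `x`.) -/
def RegularlyVarying (f : ℝ → ℝ) (β : ℝ) : Prop :=
  Measurable ((Ici (0 : ℝ)).domRestrict f) ∧
    ∀ t : ℝ, 0 < t → Tendsto (fun x => f (t * x) / f x) atTop (𝓝 (t ^ β))

/-- Boolean-subexponentiality of a probability measure `μ` on `[0, ∞)`: all tails `μ(y, ∞)` are
positive and, for each `n ≥ 1`, the `n`-fold Boolean convolution `μ ⊎ ⋯ ⊎ μ` exists and
`(μ ⊎ ⋯ ⊎ μ)(y, ∞) ∼ n μ(y, ∞)` as `y → ∞`. -/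
def BooleanSubexponential (μ : ProbabilityMeasure ℝ) : Prop :=
  SupportedOnNonneg μ ∧ (∀ y : ℝ, 0 ≤ y → 0 < measureTail μ y) ∧
    ∀ n : ℕ, 1 ≤ n →
      (∃ ρ : ProbabilityMeasure ℝ, IsBooleanPower μ n ρ) ∧
      ∀ ρ : ProbabilityMeasure ℝ, IsBooleanPower μ n ρ →
        measureTail ρ ~[atTop] fun y => (n : ℝ) * measureTail μ y

end

/-!
Write `ψ_μ(w) = ∫ t w / (1 - t w) dμ(t)`, which is `z G_μ(z) - 1` at `z = 1 / w`. The relation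
`K_ρ = n K_μ` defining the Boolean power becomes `ψ_ρ = n ψ_μ / (1 - (n - 1) ψ_μ)`.

*Tails.* For a polynomial weight with a double zero at `1`, the average over the unit circle of
`(1 - uᴹ) ^ 2 ψ_ρ(1 / u)` is `-∫ φ_M dρ`, where `φ_M(s) = 1 - (1 - min(s, 1) ^ M) ^ 2` is a smoothed
version of the indicator of `(1, ∞)` (`integral_tailKernel_eq`); the double zero absorbs the
singularity of `ψ` where the circle meets the support. Rescale `μ` by `y`. Up to an error of the
order of the tail divided by `|w - 1|`, `ψ_μ` is a polynomial `P` whose coefficients are truncated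
moments, and `ψ_ρ - n ψ_μ` is then `n P / (1 - (n - 1) P) - n P` up to an error of smaller order.
The weight only sees the coefficients of order `0`, `M`, `2 M` of this analytic function, and
these are `o(μ(y, ∞))` by Cauchy's estimates. Hence `∫ φ_M(t / y) dρ = n ∫ φ_M(t / y) dμ
+ o(μ(y, ∞))` for every large `M` (`exists_abs_integral_tailKernel_sub_le`,
`isLittleO_smoothTail_sub`). This needs no distinction according to which moments of `μ` are finite:
only the Karamata-type bound `∫ min(t / y, 1) ^ N dμ = O(μ(y, ∞))` for `N > α` is used
(`exists_truncMoment_le`). Sandwiching the indicator of `(1, ∞)` between the `φ_M`, with `M → ∞`,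
gives the equivalence of the tails (`isEquivalent_measureTail`).

*Support.* Near the negative half-line `G_ρ` is almost real, which forces `ρ` to have no mass there
(`supportedOnNonneg_of_booleanK`).

*Existence.* Let `T` be multiplication by `t` on `L²(μ)`, `E` the projection onto the constant
function `1` and `D = 1 + (√n - 1) E`. The `n`-th Boolean power is the spectral distribution of
`D T D` at the vector `1`. As `T` is unbounded, the argument works with the bounded self-adjoint
operator `(1 + D T D)⁻¹`, an explicit finite-rank modification of multiplication by `1 / (1 + t)`
(`exists_isSelfAdjoint_resolvent`), and its spectral measure, obtained from the continuous functional
calculus and the Riesz-Markov-Kakutani theorem (`exists_measure_integral_resolvent`).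
-/

/-! ### The kernel of the transform `ψ` on the unit circle -/

/-- The kernel `s w / (1 - s w)` of the transform `ψ_μ(w) = ∫ t w / (1 - t w) dμ(t)`. -/
noncomputable def psiKernel (s : ℝ) (w : ℂ) : ℂ := s * w / (1 - s * w)

/-- The transform `ψ_μ(w) = ∫ t w / (1 - t w) dμ(t)`, that is, `z G_μ(z) - 1` at `z = 1 / w`. -/
noncomputable def psiTransform (μ : Measure ℝ) (w : ℂ) : ℂ := ∫ t, psiKernel t w ∂μ

/-- The truncation `s ↦ 1 - (1 - min(s, 1) ^ M) ^ 2` of a polynomial with a zero of order `M` at the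
origin: it equals `1` on `[1, ∞)` and is tiny below `1` when `M` is large. -/
noncomputable def tailKernel (M : ℕ) (s : ℝ) : ℝ := 1 - (1 - min s 1 ^ M) ^ 2

lemma measurable_psiKernel : Measurable (fun x : ℝ × ℂ => psiKernel x.1 x.2) := by
  unfold psiKernel; fun_prop

lemma norm_sub_one_le {s : ℝ} {w : ℂ} (hs : 0 ≤ s) (hw : ‖w‖ = 1) :
    ‖w - 1‖ ≤ 2 * ‖1 - s * w‖ := by
  have h1 : ‖w - 1‖ ≤ ‖1 - s * w‖ + ‖(s : ℂ) * w - w‖ := by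
    rw [norm_sub_rev w 1]
    calc ‖1 - w‖ = ‖(1 - s * w) + ((s : ℂ) * w - w)‖ := by ring_nf
      _ ≤ _ := norm_add_le _ _
  have h2 : ‖(s : ℂ) * w - w‖ = |s - 1| := by
    rw [show (s : ℂ) * w - w = ((s - 1 : ℝ) : ℂ) * w by push_cast; ring, norm_mul, hw, mul_one,
      Complex.norm_real, Real.norm_eq_abs]
  have h3 : |s - 1| ≤ ‖1 - s * w‖ := by
    have := abs_norm_sub_norm_le ((s : ℂ) * w) 1
    rwa [norm_mul, hw, Complex.norm_real, Real.norm_eq_abs, abs_of_nonneg hs, mul_one, norm_one,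
      norm_sub_rev] at this
  linarith

lemma norm_sub_one_mul_inv_le {s : ℝ} {w : ℂ} (hs : 0 ≤ s) (hw : ‖w‖ = 1) :
    ‖w - 1‖ * ‖(1 - s * w)⁻¹‖ ≤ 2 := by
  rw [norm_inv, ← div_eq_mul_inv]
  exact div_le_of_le_mul₀ (norm_nonneg _) (by norm_num) (norm_sub_one_le hs hw)

lemma one_sub_mul_ne_zero_of_one_lt {s : ℝ} {w : ℂ} (hs : 1 < s) (hw : ‖w‖ = 1) :
    1 - (s : ℂ) * w ≠ 0 := by
  intro h
  have h1 : ‖(s : ℂ) * w‖ = 1 := by rw [← sub_eq_zero.1 h, norm_one]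
  rw [norm_mul, hw, Complex.norm_real, Real.norm_eq_abs, abs_of_pos (by linarith)] at h1
  linarith

lemma norm_sub_one_le_two {w : ℂ} (hw : ‖w‖ = 1) : ‖w - 1‖ ≤ 2 := by
  refine (norm_sub_le _ _).trans ?_
  rw [hw, norm_one]; norm_num

lemma norm_sub_one_mul_psiKernel_le {s : ℝ} {w : ℂ} (hs : 0 ≤ s) (hw : ‖w‖ = 1) :
    ‖w - 1‖ * ‖psiKernel s w‖ ≤ 4 * min s 1 := by
  have h2 := norm_sub_one_mul_inv_le hs hw
  have hz := norm_nonneg (w - 1)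
  rcases le_or_gt s 1 with h | h
  · rw [min_eq_left h, psiKernel, div_eq_mul_inv, norm_mul, norm_mul, hw, Complex.norm_real,
      Real.norm_eq_abs, abs_of_nonneg hs]
    nlinarith
  · rw [min_eq_right h.le]
    have hne := one_sub_mul_ne_zero_of_one_lt h hw
    have : psiKernel s w = (1 - s * w)⁻¹ - 1 := by unfold psiKernel; field_simp; ring
    have h3 : ‖psiKernel s w‖ ≤ ‖(1 - (s : ℂ) * w)⁻¹‖ + 1 := by
      rw [this]; exact (norm_sub_le _ _).trans (by simp)
    have := norm_sub_one_le_two hw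
    nlinarith

lemma norm_sub_one_mul_psiKernel_sub_sum_le {s : ℝ} {w : ℂ} (hs : 0 ≤ s) (hw : ‖w‖ = 1) (N : ℕ) :
    ‖w - 1‖ * ‖psiKernel s w - ∑ k ∈ Finset.range N, (min s 1 : ℝ) ^ (k + 1) * w ^ (k + 1)‖
      ≤ (4 + 2 * N) * min s 1 ^ N := by
  have h2 := norm_sub_one_mul_inv_le hs hw
  have hz := norm_nonneg (w - 1)
  rcases le_or_gt s 1 with h | h
  · rw [min_eq_left h]
    by_cases h0 : 1 - (s : ℂ) * w = 0
    · have := norm_sub_one_le hs hw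
      rw [h0, norm_zero, mul_zero] at this
      have h00 : ‖w - 1‖ = 0 := le_antisymm this hz
      rw [h00, zero_mul]; positivity
    have key : psiKernel s w - ∑ k ∈ Finset.range N, (s : ℂ) ^ (k + 1) * w ^ (k + 1)
        = (s * w) ^ (N + 1) * (1 - s * w)⁻¹ := by
      have hg := mul_neg_geom_sum ((s : ℂ) * w) N
      have : ∑ k ∈ Finset.range N, (s : ℂ) ^ (k + 1) * w ^ (k + 1)
          = (s * w) * ∑ k ∈ Finset.range N, ((s : ℂ) * w) ^ k := by
        rw [Finset.mul_sum]; exact Finset.sum_congr rfl fun k _ => by ring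
      rw [this, psiKernel, eq_mul_inv_iff_mul_eq₀ h0, sub_mul, div_mul_cancel₀ _ h0, mul_assoc,
        mul_comm _ (1 - (s : ℂ) * w), hg]
      ring
    rw [key, norm_mul, norm_pow, norm_mul, hw, mul_one, Complex.norm_real, Real.norm_eq_abs,
      abs_of_nonneg hs]
    have h4 : s ^ (N + 1) ≤ s ^ N := pow_le_pow_of_le_one hs h (Nat.le_succ N)
    have h5 : 0 ≤ s ^ (N + 1) := by positivity
    have h6 : (0 : ℝ) ≤ N * s ^ N := by positivity
    calc ‖w - 1‖ * (s ^ (N + 1) * ‖(1 - (s : ℂ) * w)⁻¹‖)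
        = s ^ (N + 1) * (‖w - 1‖ * ‖(1 - (s : ℂ) * w)⁻¹‖) := by ring
      _ ≤ s ^ (N + 1) * 2 := by gcongr
      _ ≤ _ := by nlinarith
  · have h3 := norm_sub_one_mul_psiKernel_le hs hw
    rw [min_eq_right h.le] at h3 ⊢
    have h4 : ‖∑ k ∈ Finset.range N, ((1 : ℝ) : ℂ) ^ (k + 1) * w ^ (k + 1)‖ ≤ N := by
      refine (norm_sum_le _ _).trans ?_
      simp [hw]
    have h5 := norm_sub_one_le_two hw
    have h6 := norm_sub_le (psiKernel s w)
      (∑ k ∈ Finset.range N, ((1 : ℝ) : ℂ) ^ (k + 1) * w ^ (k + 1))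
    have h7 : (0 : ℝ) ≤ N := by positivity
    rw [one_pow, mul_one]
    calc _ ≤ ‖w - 1‖ * (‖psiKernel s w‖ + N) := by gcongr; linarith
      _ ≤ _ := by nlinarith

lemma norm_one_sub_pow_le {u : ℂ} (hu : ‖u‖ = 1) (M : ℕ) : ‖1 - u ^ M‖ ≤ M * ‖u - 1‖ := by
  rw [← mul_neg_geom_sum, norm_mul, norm_sub_rev, mul_comm]
  gcongr
  refine (norm_sum_le _ _).trans ?_
  simp [hu]

lemma norm_inv_sub_one {u : ℂ} (hu : ‖u‖ = 1) : ‖u⁻¹ - 1‖ = ‖u - 1‖ := by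
  have h0 : u ≠ 0 := by rintro rfl; simp at hu
  rw [show u⁻¹ - 1 = -(u⁻¹ * (u - 1)) by field_simp; ring, norm_neg, norm_mul, norm_inv, hu]; simp

/-! ### The truncated kernels as circle integrals -/

lemma circleIntegral_one_sub_pow_sq_div_sub {M : ℕ} {s : ℝ} (hs : 0 ≤ s) :
    (∮ u in C(0, 1), (1 - u ^ M) ^ 2 / (u - s)) = 2 * Real.pi * Complex.I * (1 - tailKernel M s : ℝ)
    := by
  rcases lt_trichotomy s 1 with h | h | h
  · have := Complex.circleIntegral_div_sub_of_differentiable_on_off_countable (R := 1) (c := 0)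
      (w := (s : ℂ)) countable_empty
      (by simpa [abs_of_nonneg hs] using h) (f := fun u : ℂ => (1 - u ^ M) ^ 2)
      (by fun_prop) (fun z _ => by fun_prop)
    rw [this, tailKernel, min_eq_left h.le]; push_cast; ring
  · subst h
    -- the double zero of the numerator cancels the pole, also with the convention `0 / 0 = 0`
    have : ∀ u : ℂ, (1 - u ^ M) ^ 2 / (u - (1 : ℝ))
        = (u - 1) * (∑ k ∈ Finset.range M, u ^ k) ^ 2 := by
      intro u
      rw [← mul_neg_geom_sum]
      by_cases hu : u = 1
      · simp [hu]
      · have : u - 1 ≠ 0 := sub_ne_zero.2 hu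
        push_cast; field_simp; ring
    simp_rw [this]
    rw [Complex.circleIntegral_eq_zero_of_differentiable_on_off_countable zero_le_one
      countable_empty (by fun_prop) (fun z _ => by fun_prop)]
    simp [tailKernel]
  · have hne : ∀ u ∈ Metric.closedBall (0 : ℂ) 1, u - (s : ℂ) ≠ 0 := by
      intro u hu h0
      rw [sub_eq_zero.1 h0, mem_closedBall_zero_iff, Complex.norm_real, Real.norm_eq_abs,
        abs_of_nonneg hs] at hu
      linarith
    rw [Complex.circleIntegral_eq_zero_of_differentiable_on_off_countable zero_le_one
      countable_empty (f := fun u : ℂ => (1 - u ^ M) ^ 2 / (u - s))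
      (ContinuousOn.div (by fun_prop) (by fun_prop) hne) (fun z hz =>
        DifferentiableAt.fun_div (by fun_prop) (by fun_prop)
          (hne z (Metric.ball_subset_closedBall hz.1)))]
    simp [tailKernel, min_eq_right h.le]

/-- The truncated kernel is an average of `ψ`-kernels over the unit circle, with a weight vanishing
to second order at the point where the circle meets the half-line carrying the measures. -/
lemma integral_circleMap_psiKernel {M : ℕ} (hM : M ≠ 0) {s : ℝ} (hs : 0 ≤ s) :
    (∫ θ in (0 : ℝ)..2 * Real.pi,
      (1 - circleMap 0 1 θ ^ M) ^ 2 * psiKernel s (circleMap 0 1 θ)⁻¹)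
      = ((-(2 * Real.pi * tailKernel M s) : ℝ) : ℂ) := by
  have h1 := circleIntegral_one_sub_pow_sq_div_sub (M := M) hs
  have h0 := circleIntegral_one_sub_pow_sq_div_sub (M := M) le_rfl
  have ht0 : tailKernel M 0 = 0 := by simp [tailKernel, hM]
  have hu0 : ∀ θ : ℝ, circleMap 0 1 θ ≠ 0 := fun θ => circleMap_ne_center one_ne_zero
  have e : (∮ u in C(0, 1), ((1 - u ^ M) ^ 2 / (u - s) - (1 - u ^ M) ^ 2 / (u - (0 : ℝ))))
      = Complex.I * ∫ θ in (0 : ℝ)..2 * Real.pi,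
      (1 - circleMap 0 1 θ ^ M) ^ 2 * psiKernel s (circleMap 0 1 θ)⁻¹ := by
    rw [circleIntegral, ← intervalIntegral.integral_const_mul]
    refine intervalIntegral.integral_congr fun θ _ => ?_
    simp only [deriv_circleMap, smul_eq_mul]
    generalize hu : circleMap 0 1 θ = u
    have hu' : u ≠ 0 := hu ▸ hu0 θ
    have hun : ‖u‖ = 1 := by rw [← hu]; simp
    by_cases hus : u = s
    · have hs1 : s = 1 := by
        rw [hus, Complex.norm_real, Real.norm_eq_abs, abs_of_nonneg hs] at hun; exact hun
      rw [hus, hs1]; simp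
    · have hus' : u - s ≠ 0 := sub_ne_zero.2 hus
      have : psiKernel s u⁻¹ = s / (u - s) := by
        unfold psiKernel; field_simp
      rw [this]; push_cast; field_simp; ring
  have hci : ∀ s : ℝ, 0 ≤ s → CircleIntegrable (fun u : ℂ => (1 - u ^ M) ^ 2 / (u - s)) 0 1 := by
    intro s hs
    rcases eq_or_ne s 1 with h | h
    · have : (fun u : ℂ => (1 - u ^ M) ^ 2 / (u - s))
          = fun u => (u - 1) * (∑ k ∈ Finset.range M, u ^ k) ^ 2 := by
        funext u
        rw [← mul_neg_geom_sum, h]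
        by_cases hu : u = 1
        · simp [hu]
        · have : u - 1 ≠ 0 := sub_ne_zero.2 hu
          push_cast; field_simp; ring
      rw [this]
      exact ContinuousOn.circleIntegrable zero_le_one (by fun_prop)
    · refine ContinuousOn.circleIntegrable zero_le_one (ContinuousOn.div (by fun_prop)
        (by fun_prop) fun u hu h0 => h ?_)
      rw [sub_eq_zero.1 h0, mem_sphere_zero_iff_norm, Complex.norm_real, Real.norm_eq_abs,
        abs_of_nonneg hs] at hu
      exact hu
  rw [circleIntegral.integral_sub (hci s hs) (hci 0 le_rfl), h1, h0, ht0] at e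
  apply mul_left_cancel₀ Complex.I_ne_zero
  rw [← e]; push_cast; ring

lemma norm_weight_mul_psiKernel_le {M : ℕ} {s : ℝ} (hs : 0 ≤ s) {u : ℂ} (hu : ‖u‖ = 1) :
    ‖(1 - u ^ M) ^ 2 * psiKernel s u⁻¹‖ ≤ 8 * M ^ 2 := by
  have h1 := norm_one_sub_pow_le hu M
  have h2 := norm_sub_one_mul_psiKernel_le hs (w := u⁻¹) (by simp [hu])
  rw [norm_inv_sub_one hu] at h2
  have h3 := norm_sub_one_le_two hu
  have h4 : min s 1 ≤ 1 := min_le_right _ _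
  rw [norm_mul, norm_pow]
  calc _ ≤ (M * ‖u - 1‖) ^ 2 * ‖psiKernel s u⁻¹‖ := by gcongr
    _ = M ^ 2 * (‖u - 1‖ * (‖u - 1‖ * ‖psiKernel s u⁻¹‖)) := by ring
    _ ≤ M ^ 2 * (2 * 4) := by gcongr; linarith
    _ = _ := by ring

lemma integral_tailKernel_eq (μ : Measure ℝ) [IsProbabilityMeasure μ] (hμ : ∀ᵐ t ∂μ, 0 ≤ t)
    {M : ℕ} (hM : M ≠ 0) :
    IntervalIntegrable (fun θ : ℝ => (1 - circleMap 0 1 θ ^ M) ^ 2 *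
      psiTransform μ (circleMap 0 1 θ)⁻¹) volume 0 (2 * Real.pi) ∧
    (∫ θ in (0 : ℝ)..2 * Real.pi,
      (1 - circleMap 0 1 θ ^ M) ^ 2 * psiTransform μ (circleMap 0 1 θ)⁻¹)
      = ((-(2 * Real.pi * ∫ t, tailKernel M t ∂μ) : ℝ) : ℂ) := by
  set F : ℝ → ℝ → ℂ := fun θ t =>
    (1 - circleMap 0 1 θ ^ M) ^ 2 * psiKernel t (circleMap 0 1 θ)⁻¹ with hF
  have hmeas : Measurable (fun x : ℝ × ℝ => F x.1 x.2) := by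
    have hc : Measurable (circleMap 0 1) := (continuous_circleMap 0 1).measurable
    have h1 : Measurable (fun x : ℝ × ℝ => circleMap 0 1 x.1) := hc.comp measurable_fst
    exact ((measurable_const.sub (h1.pow_const M)).pow_const 2).mul
      (measurable_psiKernel.comp (measurable_snd.prodMk h1.inv))
  have hint : Integrable (fun x : ℝ × ℝ => F x.1 x.2)
      ((volume.restrict (Ioc 0 (2 * Real.pi))).prod μ) := by
    refine Integrable.of_bound hmeas.aestronglyMeasurable (8 * M ^ 2) ?_
    have : ∀ᵐ x ∂((volume.restrict (Ioc 0 (2 * Real.pi))).prod μ), 0 ≤ x.2 :=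
      Measure.quasiMeasurePreserving_snd.ae hμ
    filter_upwards [this] with x hx
    exact norm_weight_mul_psiKernel_le hx (by simp)
  have hpt : ∀ θ, ∫ t, F θ t ∂μ =
      (1 - circleMap 0 1 θ ^ M) ^ 2 * psiTransform μ (circleMap 0 1 θ)⁻¹ := fun θ => by
    rw [hF, psiTransform, integral_const_mul]
  have hpi : (0 : ℝ) ≤ 2 * Real.pi := by positivity
  constructor
  · rw [intervalIntegrable_iff_integrableOn_Ioc_of_le hpi]
    refine hint.integral_prod_left.congr (ae_of_all _ fun θ => hpt θ)
  · simp_rw [← hpt]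
    rw [intervalIntegral.integral_of_le hpi, integral_integral_swap hint]
    rw [← integral_const_mul, ← integral_neg, ← integral_complex_ofReal]
    refine integral_congr_ae ?_
    filter_upwards [hμ] with t ht
    rw [← intervalIntegral.integral_of_le hpi, integral_circleMap_psiKernel hM ht]

/-! ### Polynomial approximation of `ψ` by truncated moments -/

lemma integrable_min_pow (μ : Measure ℝ) [IsFiniteMeasure μ] (hμ : ∀ᵐ t ∂μ, 0 ≤ t) (k : ℕ) :
    Integrable (fun t : ℝ => min t 1 ^ k) μ := by
  refine Integrable.of_bound (by fun_prop) 1 ?_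
  filter_upwards [hμ] with t ht
  have h0 : 0 ≤ min t 1 := le_min ht zero_le_one
  rw [Real.norm_eq_abs, abs_of_nonneg (by positivity)]
  exact pow_le_one₀ h0 (min_le_right _ _)

lemma integrable_psiKernel (μ : Measure ℝ) [IsFiniteMeasure μ] (hμ : ∀ᵐ t ∂μ, 0 ≤ t) {w : ℂ}
    (hw : ‖w‖ = 1) (hw1 : w ≠ 1) : Integrable (fun t => psiKernel t w) μ := by
  have hpos : 0 < ‖w - 1‖ := norm_pos_iff.2 (sub_ne_zero.2 hw1)
  refine Integrable.of_bound
    (measurable_psiKernel.comp (measurable_id.prodMk measurable_const)).aestronglyMeasurable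
    (4 / ‖w - 1‖) ?_
  filter_upwards [hμ] with t ht
  rw [le_div_iff₀ hpos, mul_comm]
  have := norm_sub_one_mul_psiKernel_le ht hw
  have h4 : min t 1 ≤ 1 := min_le_right _ _
  linarith

lemma norm_sub_one_mul_psiTransform_le (μ : Measure ℝ) [IsFiniteMeasure μ]
    (hμ : ∀ᵐ t ∂μ, 0 ≤ t) {w : ℂ} (hw : ‖w‖ = 1) :
    ‖w - 1‖ * ‖psiTransform μ w‖ ≤ 4 * ∫ t, min t 1 ∂μ := by
  rw [← norm_mul, psiTransform, ← integral_const_mul, ← integral_const_mul]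
  have h1 := (integrable_min_pow μ hμ 1).const_mul 4
  simp only [pow_one] at h1
  refine norm_integral_le_of_norm_le h1 ?_
  filter_upwards [hμ] with t ht
  rw [norm_mul]; exact norm_sub_one_mul_psiKernel_le ht hw

/-- The polynomial whose coefficients of order `1 ≤ k ≤ N` are the truncated moments
`∫ min(t, 1) ^ k dμ`; it approximates `ψ_μ` on the unit circle. -/
noncomputable def truncPsi (μ : Measure ℝ) (N : ℕ) (w : ℂ) : ℂ :=
  ∑ k ∈ Finset.range N, (∫ t, min t 1 ^ (k + 1) ∂μ : ℝ) * w ^ (k + 1)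

lemma norm_sub_one_mul_psiTransform_sub_truncPsi_le (μ : Measure ℝ) [IsFiniteMeasure μ]
    (hμ : ∀ᵐ t ∂μ, 0 ≤ t) {w : ℂ} (hw : ‖w‖ = 1) (N : ℕ) :
    ‖w - 1‖ * ‖psiTransform μ w - truncPsi μ N w‖ ≤ (4 + 2 * N) * ∫ t, min t 1 ^ N ∂μ := by
  by_cases hw1 : w = 1
  · have h0 : 0 ≤ ∫ t, min t 1 ^ N ∂μ := by
      refine integral_nonneg_of_ae ?_
      filter_upwards [hμ] with t ht
      have : 0 ≤ min t 1 := le_min ht zero_le_one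
      positivity
    rw [hw1, sub_self, norm_zero, zero_mul]; positivity
  have hint : ∀ k ∈ Finset.range N,
      Integrable (fun t : ℝ => ((min t 1 : ℝ) : ℂ) ^ (k + 1) * w ^ (k + 1)) μ := by
    intro k _
    have := ((integrable_min_pow μ hμ (k + 1)).ofReal (𝕜 := ℂ)).mul_const (w ^ (k + 1))
    simpa using this
  have e : truncPsi μ N w
      = ∫ t, ∑ k ∈ Finset.range N, ((min t 1 : ℝ) : ℂ) ^ (k + 1) * w ^ (k + 1) ∂μ := by
    rw [integral_finsetSum _ hint, truncPsi]
    refine Finset.sum_congr rfl fun k _ => ?_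
    rw [integral_mul_const, ← integral_complex_ofReal]
    simp
  rw [e, psiTransform, ← integral_sub (integrable_psiKernel μ hμ hw hw1)
    (integrable_finsetSum _ hint), ← norm_mul, ← integral_const_mul, ← integral_const_mul]
  refine norm_integral_le_of_norm_le ((integrable_min_pow μ hμ N).const_mul _) ?_
  filter_upwards [hμ] with t ht
  rw [norm_mul]
  exact norm_sub_one_mul_psiKernel_sub_sum_le ht hw N

/-- Young's inequality `(x / b) ^ k ≤ 1 + (x / b) ^ N` shows that the `k`-th truncated moment is at
most of the order of the `k / N`-th power of the `N`-th one. -/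
lemma integral_min_pow_le (μ : Measure ℝ) [IsProbabilityMeasure μ] (hμ : ∀ᵐ t ∂μ, 0 ≤ t) {N k : ℕ}
    (hk : k ≤ N) {b : ℝ} (hb : 0 < b) (hT : ∫ t, min t 1 ^ N ∂μ = b ^ N) :
    ∫ t, min t 1 ^ k ∂μ ≤ 2 * b ^ k := by
  have hi := integrable_min_pow μ hμ
  have hbk : 0 < b ^ k := by positivity
  have hbN : 0 < b ^ N := by positivity
  calc ∫ t, min t 1 ^ k ∂μ ≤ ∫ t, (b ^ k + b ^ k / b ^ N * min t 1 ^ N) ∂μ := by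
        refine integral_mono_ae (hi k) ((integrable_const _).add ((hi N).const_mul _)) ?_
        filter_upwards [hμ] with t ht
        have h0 : 0 ≤ min t 1 := le_min ht zero_le_one
        have hx : 0 ≤ min t 1 / b := by positivity
        have key : (min t 1 / b) ^ k ≤ 1 + (min t 1 / b) ^ N := by
          rcases le_total (min t 1 / b) 1 with h | h
          · have := pow_le_one₀ hx h (n := k)
            have : 0 ≤ (min t 1 / b) ^ N := by positivity
            linarith
          · have := pow_le_pow_right₀ h hk
            linarith
        rw [div_pow, div_pow, div_le_iff₀ hbk] at key
        calc _ ≤ _ := key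
          _ = _ := by field_simp
    _ = b ^ k + b ^ k / b ^ N * b ^ N := by
        rw [integral_add (integrable_const _) ((hi N).const_mul _), integral_const_mul, hT]; simp
    _ = 2 * b ^ k := by field_simp; ring

lemma norm_truncPsi_le (μ : Measure ℝ) [IsProbabilityMeasure μ] (hμ : ∀ᵐ t ∂μ, 0 ≤ t) {N : ℕ}
    {b x : ℝ} (hb : 0 < b) (hT : ∫ t, min t 1 ^ N ∂μ = b ^ N) {w : ℂ} (hx : x ≤ 1)
    (hw : b * ‖w‖ ≤ x) : ‖truncPsi μ N w‖ ≤ 2 * N * x := by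
  have hx0 : 0 ≤ b * ‖w‖ := by positivity
  have : ∀ k ∈ Finset.range N,
      ‖((∫ t, min t 1 ^ (k + 1) ∂μ : ℝ) : ℂ) * w ^ (k + 1)‖ ≤ 2 * x := by
    intro k hk
    have h0 : 0 ≤ ∫ t, min t 1 ^ (k + 1) ∂μ := by
      refine integral_nonneg_of_ae ?_
      filter_upwards [hμ] with t ht
      have : 0 ≤ min t 1 := le_min ht zero_le_one
      positivity
    rw [norm_mul, norm_pow, Complex.norm_real, Real.norm_eq_abs, abs_of_nonneg h0]
    calc _ ≤ 2 * b ^ (k + 1) * ‖w‖ ^ (k + 1) := by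
          gcongr; exact integral_min_pow_le μ hμ (Finset.mem_range.1 hk) hb hT
      _ = 2 * (b * ‖w‖) ^ (k + 1) := by rw [mul_pow]; ring
      _ ≤ 2 * (b * ‖w‖) := by
          gcongr
          exact pow_le_of_le_one hx0 (hw.trans hx) (Nat.succ_ne_zero k)
      _ ≤ 2 * x := by gcongr
  refine (norm_sum_le_of_le _ this).trans ?_
  simp; linarith

/-! ### Circle averages of functions analytic in a large disc -/

lemma integral_circleMap_inv (f : ℂ → ℂ) :
    (∫ θ in (0 : ℝ)..2 * Real.pi, f (circleMap 0 1 θ)⁻¹)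
      = ∫ θ in (0 : ℝ)..2 * Real.pi, f (circleMap 0 1 θ) := by
  have := intervalIntegral.integral_comp_sub_left (fun θ => f (circleMap 0 1 θ)) (2 * Real.pi)
    (a := 0) (b := 2 * Real.pi)
  rw [sub_zero, sub_self] at this
  rw [← this]
  refine intervalIntegral.integral_congr fun θ _ => ?_
  simp only [circleMap, zero_add, Complex.ofReal_one, one_mul, ← Complex.exp_neg]
  congr 1
  rw [Complex.exp_eq_exp_iff_exists_int]
  exact ⟨-1, by push_cast; ring⟩

/-- The weight `(1 - u⁻ᴹ) ^ 2` only sees the Taylor coefficients of order `0`, `M` and `2 M`, which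
are controlled by Cauchy's estimates on a large circle. -/
lemma norm_integral_weight_mul_le {H : ℂ → ℂ} {W B : ℝ} (hW : 1 ≤ W) (M : ℕ)
    (hd : ∀ w, ‖w‖ ≤ W → DifferentiableAt ℂ H w) (h0 : H 0 = 0) (hB : ∀ w, ‖w‖ ≤ W → ‖H w‖ ≤ B) :
    ‖∫ θ in (0 : ℝ)..2 * Real.pi, (1 - (circleMap 0 1 θ)⁻¹ ^ M) ^ 2 * H (circleMap 0 1 θ)‖
      ≤ 2 * Real.pi * (3 * B / W ^ M) := by
  have hW0 : 0 < W := by linarith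
  have hB0 : 0 ≤ B := (norm_nonneg _).trans (hB 0 (by simp [hW0.le]))
  set f : ℂ → ℂ := fun u => (1 - u⁻¹ ^ M) ^ 2 * H u * u⁻¹ with hf
  have hdf : ∀ u, u ≠ 0 → ‖u‖ ≤ W → DifferentiableAt ℂ f u := by
    intro u hu huW
    have := hd u huW
    have h2 : DifferentiableAt ℂ (fun u : ℂ => u⁻¹) u := differentiableAt_inv hu
    exact ((((differentiableAt_const _).sub (h2.pow M)).pow 2).mul this).mul h2
  have e1 : (∮ u in C(0, 1), f u) = Complex.I *
      ∫ θ in (0 : ℝ)..2 * Real.pi, (1 - (circleMap 0 1 θ)⁻¹ ^ M) ^ 2 * H (circleMap 0 1 θ) := by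
    rw [circleIntegral, ← intervalIntegral.integral_const_mul]
    refine intervalIntegral.integral_congr fun θ _ => ?_
    have : circleMap 0 1 θ ≠ 0 := circleMap_ne_center one_ne_zero
    simp only [deriv_circleMap, smul_eq_mul, hf]
    field_simp
  have e2 : (∮ u in C(0, W), f u) = ∮ u in C(0, 1), f u := by
    refine Complex.circleIntegral_eq_of_differentiable_on_annulus_off_countable one_pos hW
      countable_empty (fun u hu => (hdf u ?_ ?_).continuousAt.continuousWithinAt)
      (fun u hu => hdf u ?_ ?_)
    · rintro rfl; simp at hu
    · simpa using hu.1
    · rintro rfl; simp at hu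
    · have := hu.1.1; simp at this; exact this.le
  have e3 : (∮ u in C(0, W), H u / (u - 0)) = 0 := by
    rw [Complex.circleIntegral_div_sub_of_differentiable_on_off_countable (s := ∅) countable_empty
      (by simpa using hW0)
      (fun u hu => (hd u (by simpa using hu)).continuousAt.continuousWithinAt)
      (fun u hu => hd u (by have := hu.1; simp at this; exact this.le)), h0, mul_zero]
  have hne : ∀ u ∈ Metric.sphere (0 : ℂ) W, u ≠ 0 := by
    rintro u hu rfl; simp at hu; linarith
  have hle : ∀ u ∈ Metric.sphere (0 : ℂ) W, ‖u‖ ≤ W := by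
    intro u hu; simp at hu; exact hu.le
  have e4 : (∮ u in C(0, W), f u) = ∮ u in C(0, W), (f u - H u / (u - 0)) := by
    rw [circleIntegral.integral_sub, e3, sub_zero]
    · exact ContinuousOn.circleIntegrable hW0.le fun u hu =>
        (hdf u (hne u hu) (hle u hu)).continuousAt.continuousWithinAt
    · refine ContinuousOn.circleIntegrable hW0.le (ContinuousOn.div (fun u hu =>
        (hd u (hle u hu)).continuousAt.continuousWithinAt) (by fun_prop) ?_)
      intro u hu; simpa using hne u hu
  have e5 : ‖∮ u in C(0, W), (f u - H u / (u - 0))‖ ≤ 2 * Real.pi * W * (3 * B / W ^ M / W) := by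
    refine circleIntegral.norm_integral_le_of_norm_le_const hW0.le fun u hu => ?_
    have hu0 := hne u hu
    have hun : ‖u‖ = W := by simpa using hu
    have : f u - H u / (u - 0) = (u⁻¹ ^ M * (u⁻¹ ^ M - 2)) * H u * u⁻¹ := by
      simp only [hf, sub_zero]; field_simp; ring
    rw [this, norm_mul, norm_mul, norm_mul, norm_pow, norm_inv, hun]
    have h6 : ‖u⁻¹ ^ M - 2‖ ≤ 3 := by
      refine (norm_sub_le _ _).trans ?_
      rw [norm_pow, norm_inv, hun]
      have : W⁻¹ ^ M ≤ 1 := pow_le_one₀ (by positivity) (inv_le_one_of_one_le₀ hW)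
      have h2 : ‖(2 : ℂ)‖ = 2 := by simp
      linarith
    calc _ ≤ W⁻¹ ^ M * 3 * B * W⁻¹ := by gcongr; exact hB u hun.le
      _ = _ := by rw [inv_pow]; field_simp
  calc _ = ‖∮ u in C(0, 1), f u‖ := by rw [e1, norm_mul]; simp
    _ ≤ 2 * Real.pi * W * (3 * B / W ^ M / W) := by rw [← e2, e4]; exact e5
    _ = _ := by field_simp

/-! ### Comparison of the smoothed tails at a fixed scale -/

/-- If `ψ_ρ = n ψ_μ / (1 - (n - 1) ψ_μ)` on the unit circle, then the smoothed tails of `ρ` and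
`n μ` at scale `1` differ by a small multiple of the `N`-th truncated moment `b ^ N` of `μ`.

Up to `O(b ^ N)`, the transform `ψ_μ` is a polynomial `P` whose `k`-th coefficient is `O(b ^ k)`, so
that the coefficients of order `M = N + 1` and `2 M` of `n P / (1 - (n - 1) P) - n P` are
`O(b ^ (N + 1))`; this function vanishes at `0`, and the weight in the representation of the smoothed
tail ignores all other coefficients. -/
theorem exists_abs_integral_tailKernel_sub_le {N n : ℕ} (hN : 1 ≤ N) (hn : 1 ≤ n) :
    ∃ C r : ℝ, 0 ≤ C ∧ 0 < r ∧ ∀ (μ ρ : Measure ℝ) [IsProbabilityMeasure μ]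
      [IsProbabilityMeasure ρ], (∀ᵐ t ∂μ, 0 ≤ t) → (∀ᵐ t ∂ρ, 0 ≤ t) →
      (∀ w : ℂ, w.im ≠ 0 → psiTransform ρ w
        = n * psiTransform μ w + (n - 1) * psiTransform μ w * psiTransform ρ w) →
      ∀ b : ℝ, 0 < b → b ≤ r → ∫ t, min t 1 ^ N ∂μ = b ^ N →
      |∫ t, tailKernel (N + 1) t ∂ρ - n * ∫ t, tailKernel (N + 1) t ∂μ|
        ≤ C * b ^ N * (b + ∫ t, min t 1 ∂ρ) := by
  have hn' : (1 : ℝ) ≤ n := by exact_mod_cast hn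
  have hN' : (1 : ℝ) ≤ N := by exact_mod_cast hN
  set r : ℝ := 1 / (4 * N * n) with hr
  have hr0 : 0 < r := by positivity
  have hr1 : r ≤ 1 := by
    rw [hr, div_le_one (by positivity)]; nlinarith
  set A : ℝ := (N + 1) ^ 2 * (2 * n ^ 2 * (4 + 2 * N) * (4 + 4 * N)) with hA
  have hA0 : 0 ≤ A := by positivity
  refine ⟨A + 3 / r ^ (N + 1), r, by positivity, hr0, ?_⟩
  intro μ ρ _ _ hμ hρ hrel b hb hbr hT
  set M := N + 1 with hM
  have hM0 : M ≠ 0 := Nat.succ_ne_zero N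
  set ε := ∫ t, min t 1 ∂ρ with hε
  have hε0 : 0 ≤ ε := by
    refine integral_nonneg_of_ae ?_
    filter_upwards [hρ] with t ht
    exact le_min ht zero_le_one
  set c : ℝ := n - 1 with hc
  have hc0 : 0 ≤ c := by linarith
  have hcn : c ≤ n := by linarith
  set P := truncPsi μ N with hP
  set H : ℂ → ℂ := fun w => n * c * P w ^ 2 / (1 - c * P w) with hH
  set W := r / b with hWdef
  have hW : 1 ≤ W := (one_le_div hb).2 hbr
  -- as `|P w| ≤ ∑ 2 (b |w|) ^ k`, the choice of `r` keeps `c P` below `1 / 2` on the large disc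
  have hPW : ∀ w, ‖w‖ ≤ W → ‖P w‖ ≤ 1 / (2 * n) := by
    intro w hw
    refine (norm_truncPsi_le μ hμ hb hT hr1 ?_).trans_eq ?_
    · calc b * ‖w‖ ≤ b * W := by gcongr
        _ = r := by rw [hWdef]; field_simp
    · rw [hr]; field_simp; norm_num
  have hden : ∀ w, ‖w‖ ≤ W → 1 / 2 ≤ ‖1 - (c : ℂ) * P w‖ := by
    intro w hw
    have h1 : ‖(c : ℂ) * P w‖ ≤ 1 / 2 := by
      rw [norm_mul, Complex.norm_real, Real.norm_eq_abs, abs_of_nonneg hc0]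
      calc c * ‖P w‖ ≤ n * (1 / (2 * n)) := by gcongr; exact hPW w hw
        _ = 1 / 2 := by field_simp
    have h2 := norm_sub_norm_le (1 : ℂ) ((c : ℂ) * P w)
    rw [norm_one] at h2
    linarith
  have hden0 : ∀ w, ‖w‖ ≤ W → 1 - (c : ℂ) * P w ≠ 0 := by
    intro w hw h0
    have := hden w hw
    rw [h0, norm_zero] at this
    linarith
  have hPd : Differentiable ℂ P := by
    rw [hP]; unfold truncPsi; fun_prop
  have hHd : ∀ w, ‖w‖ ≤ W → DifferentiableAt ℂ H w := by
    intro w hw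
    have := hPd w
    exact DifferentiableAt.div (by fun_prop) (by fun_prop) (hden0 w hw)
  have hHB : ∀ w, ‖w‖ ≤ W → ‖H w‖ ≤ 1 := by
    intro w hw
    have h1 := hPW w hw
    have h2 := hden w hw
    rw [hH]
    simp only [norm_div, norm_mul, norm_pow, Complex.norm_real, Complex.norm_natCast,
      Real.norm_eq_abs, abs_of_nonneg hc0]
    rw [div_le_one (by linarith)]
    calc n * c * ‖P w‖ ^ 2 ≤ n * n * (1 / (2 * n)) ^ 2 := by gcongr
      _ ≤ 1 / 2 := by field_simp; norm_num
      _ ≤ _ := h2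
  have hH0 : H 0 = 0 := by simp [hH, hP, truncPsi]
  have hmain := norm_integral_weight_mul_le hW M hHd hH0 hHB
  rw [← integral_circleMap_inv (fun u => (1 - u⁻¹ ^ M) ^ 2 * H u)] at hmain
  simp only [inv_inv] at hmain
  obtain ⟨hiμ, heμ⟩ := integral_tailKernel_eq μ hμ hM0
  obtain ⟨hiρ, heρ⟩ := integral_tailKernel_eq ρ hρ hM0
  have hiH : IntervalIntegrable (fun θ : ℝ => (1 - circleMap 0 1 θ ^ M) ^ 2 *
      H (circleMap 0 1 θ)⁻¹) volume 0 (2 * Real.pi) := by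
    refine Continuous.intervalIntegrable ?_ _ _
    have hcm := continuous_circleMap 0 1
    have hinv : Continuous fun θ => (circleMap 0 1 θ)⁻¹ :=
      hcm.inv₀ fun θ => circleMap_ne_center one_ne_zero
    refine ((continuous_const.sub (hcm.pow M)).pow 2).mul (continuous_iff_continuousAt.2 fun θ => ?_)
    exact (hHd _ (by simp [hW])).continuousAt.comp' hinv.continuousAt
  have herr : ∀ᵐ θ : ℝ, ‖(1 - circleMap 0 1 θ ^ M) ^ 2 * psiTransform ρ (circleMap 0 1 θ)⁻¹
      - n * ((1 - circleMap 0 1 θ ^ M) ^ 2 * psiTransform μ (circleMap 0 1 θ)⁻¹)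
      - (1 - circleMap 0 1 θ ^ M) ^ 2 * H (circleMap 0 1 θ)⁻¹‖ ≤ A * b ^ N * (b + ε) := by
    have hcount : (range fun k : ℤ => (k : ℝ) * Real.pi).Countable := countable_range _
    have hae : ∀ᵐ θ : ℝ, θ ∉ range fun k : ℤ => (k : ℝ) * Real.pi :=
      compl_mem_ae_iff.2 (hcount.measure_zero volume)
    filter_upwards [hae] with θ hθ
    have hs : Real.sin θ ≠ 0 := fun h => hθ (Real.sin_eq_zero_iff.1 h)
    have hun : ‖circleMap 0 1 θ‖ = 1 := by simp
    have him : (circleMap 0 1 θ)⁻¹.im ≠ 0 := by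
      rw [Complex.inv_im, Complex.normSq_eq_norm_sq, hun]
      simpa [circleMap, Complex.exp_ofReal_mul_I_im] using hs
    generalize circleMap 0 1 θ = u at hun him
    set w := u⁻¹ with hw
    have hwn : ‖w‖ = 1 := by simp [hw, hun]
    have hrw := hrel w him
    set m := psiTransform μ w
    set q := psiTransform ρ w
    have hwW : ‖w‖ ≤ W := by rw [hwn]; exact hW
    have hd := hden0 w hwW
    have hnC : (n : ℂ) ≠ 0 := by exact_mod_cast (by omega : n ≠ 0)
    have hcC : (c : ℂ) = n - 1 := by simp [hc]
    -- the identity `1 / (1 - c m) = 1 + (c / n) q` avoids dividing by `1 - c m`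
    have key : q - n * m - H w = (m - P w) * ((c * q + n * c * P w) / (1 - c * P w)) := by
      rw [← hcC] at hrw
      simp only [hH]
      rw [← mul_div_assoc, sub_eq_iff_eq_add, ← add_div, eq_div_iff hd]
      linear_combination hrw
    have hpw : ‖(1 - u ^ M) ^ 2‖ ≤ (N + 1) ^ 2 * ‖w - 1‖ ^ 2 := by
      have := norm_one_sub_pow_le hun M
      rw [norm_pow, ← mul_pow, hw, norm_inv_sub_one hun]
      gcongr
      simpa [hM] using this
    have h1 := norm_sub_one_mul_psiTransform_sub_truncPsi_le μ hμ hwn N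
    rw [hT] at h1
    have h2 := norm_sub_one_mul_psiTransform_le ρ hρ hwn
    have h3 : ‖P w‖ ≤ 2 * N * b :=
      norm_truncPsi_le μ hμ hb hT (hbr.trans hr1) (by rw [hwn, mul_one])
    have h4 := hden w hwW
    have h5 := norm_sub_one_le_two hwn
    have h6 : ‖w - 1‖ * (‖(c * q + n * c * P w) / (1 - c * P w)‖)
        ≤ 2 * n ^ 2 * ((4 + 4 * N) * (b + ε)) := by
      rw [norm_div]
      have h7 : ‖(c : ℂ) * q + n * c * P w‖ ≤ n ^ 2 * (‖q‖ + ‖P w‖) := by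
        refine (norm_add_le _ _).trans ?_
        simp only [norm_mul, Complex.norm_real, Complex.norm_natCast, Real.norm_eq_abs,
          abs_of_nonneg hc0]
        have : c ≤ (n : ℝ) ^ 2 := by nlinarith
        have h8 : n * c ≤ (n : ℝ) ^ 2 := by nlinarith
        rw [mul_add]
        gcongr
      calc ‖w - 1‖ * (‖(c : ℂ) * q + n * c * P w‖ / ‖1 - c * P w‖)
          ≤ ‖w - 1‖ * ((n ^ 2 * (‖q‖ + ‖P w‖)) / (1 / 2)) := by gcongr
        _ = 2 * n ^ 2 * (‖w - 1‖ * ‖q‖ + ‖w - 1‖ * ‖P w‖) := by ring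
        _ ≤ 2 * n ^ 2 * (4 * ε + 2 * (2 * N * b)) := by gcongr
        _ ≤ _ := by
          gcongr
          have : 0 ≤ N * ε := by positivity
          linarith
    rw [show (1 - u ^ M) ^ 2 * q - n * ((1 - u ^ M) ^ 2 * m) - (1 - u ^ M) ^ 2 * H w
      = (1 - u ^ M) ^ 2 * (q - n * m - H w) by ring, key, norm_mul, norm_mul]
    calc _ ≤ ((N + 1) ^ 2 * ‖w - 1‖ ^ 2) * (‖m - P w‖ *
          ‖(c * q + n * c * P w) / (1 - c * P w)‖) := by gcongr
      _ = (N + 1) ^ 2 * ((‖w - 1‖ * ‖m - P w‖) *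
          (‖w - 1‖ * ‖(c * q + n * c * P w) / (1 - c * P w)‖)) := by ring
      _ ≤ (N + 1) ^ 2 * (((4 + 2 * N) * b ^ N) * (2 * n ^ 2 * ((4 + 4 * N) * (b + ε)))) := by
          gcongr
      _ = _ := by rw [hA]; ring
  have hpi : 0 < 2 * Real.pi := by positivity
  have hI := intervalIntegral.norm_integral_le_of_norm_le_const_ae (a := 0) (b := 2 * Real.pi)
    (herr.mono fun θ h _ => h)
  rw [intervalIntegral.integral_sub (hiρ.sub (hiμ.const_mul _)) hiH,
    intervalIntegral.integral_sub hiρ (hiμ.const_mul _), intervalIntegral.integral_const_mul,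
    heμ, heρ, sub_zero, abs_of_pos hpi] at hI
  have hWM : 3 * 1 / W ^ M = 3 / r ^ (N + 1) * b ^ N * b := by
    rw [hWdef, div_pow, hM]; field_simp; ring
  rw [hWM] at hmain
  set J := ∫ θ in (0 : ℝ)..2 * Real.pi, (1 - circleMap 0 1 θ ^ M) ^ 2 * H (circleMap 0 1 θ)⁻¹
  set X := ∫ t, tailKernel M t ∂ρ
  set Y := ∫ t, tailKernel M t ∂μ
  have hfin : ‖((2 * Real.pi * (X - n * Y) : ℝ) : ℂ)‖
      ≤ A * b ^ N * (b + ε) * (2 * Real.pi) + 2 * Real.pi * (3 / r ^ (N + 1) * b ^ N * b) := by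
    refine le_trans ?_ (add_le_add hI hmain)
    refine le_trans (le_of_eq ?_) (norm_add_le _ _)
    rw [← norm_neg]; congr 1; push_cast; ring
  rw [Complex.norm_real, Real.norm_eq_abs, abs_mul, abs_of_pos hpi] at hfin
  have : 0 ≤ 3 / r ^ (N + 1) * b ^ N * ε := by positivity
  refine le_of_mul_le_mul_left (hfin.trans ?_) hpi
  nlinarith [mul_nonneg hpi.le this]

/-! ### Smoothed tails and truncated moments of a measure with regularly varying tail -/

lemma measureTail_antitone (μ : ProbabilityMeasure ℝ) : Antitone (measureTail μ) :=
  fun _ _ h => measureReal_mono (Ioi_subset_Ioi h)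

lemma measureTail_nonneg (μ : ProbabilityMeasure ℝ) (y : ℝ) : 0 ≤ measureTail μ y :=
  measureReal_nonneg

lemma tendsto_measureTail (μ : ProbabilityMeasure ℝ) : Tendsto (measureTail μ) atTop (𝓝 0) := by
  have h := tendsto_measure_iInter_atTop (μ := (μ : Measure ℝ)) (s := fun y : ℝ => Ioi y)
    (fun _ => measurableSet_Ioi.nullMeasurableSet) (fun _ _ h => Ioi_subset_Ioi h)
    ⟨0, measure_ne_top _ _⟩
  have he : (⋂ y : ℝ, Ioi y) = ∅ := by
    ext x; simp only [mem_iInter, mem_Ioi, mem_empty_iff_false, iff_false, not_forall]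
    exact ⟨x, lt_irrefl x⟩
  rw [he, measure_empty] at h
  exact (ENNReal.tendsto_toReal ENNReal.zero_ne_top).comp h

/-- Regular variation with ratio `t = 1` forces the tail to be nonzero far out, hence everywhere. -/
lemma measureTail_pos {μ : ProbabilityMeasure ℝ} {β : ℝ} (h : RegularlyVarying (measureTail μ) β)
    (y : ℝ) : 0 < measureTail μ y := by
  have h1 := h.2 1 one_pos
  rw [Real.one_rpow] at h1
  have h2 : ∀ᶠ x in atTop, measureTail μ x ≠ 0 := by
    filter_upwards [h1.eventually (lt_mem_nhds zero_lt_one)] with x hx h0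
    rw [h0, div_zero] at hx; exact lt_irrefl _ hx
  obtain ⟨x, hx, hxy⟩ := (h2.and (eventually_ge_atTop y)).exists
  exact ((measureTail_nonneg μ x).lt_of_ne' hx).trans_le (measureTail_antitone μ hxy)

lemma SupportedOnNonneg.ae_nonneg {μ : ProbabilityMeasure ℝ} (h : SupportedOnNonneg μ) :
    ∀ᵐ t ∂(μ : Measure ℝ), 0 ≤ t := by
  rw [ae_iff]; simpa [SupportedOnNonneg, Iio] using h

/-- The truncated moment `∫ min(t / y, 1) ^ k dμ` at scale `y`. -/
noncomputable def truncMoment (μ : ProbabilityMeasure ℝ) (k : ℕ) (y : ℝ) : ℝ :=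
  ∫ t, min (t / y) 1 ^ k ∂(μ : Measure ℝ)

/-- The smoothed tail of `μ` at scale `y`. -/
noncomputable def smoothTail (μ : ProbabilityMeasure ℝ) (M : ℕ) (y : ℝ) : ℝ :=
  ∫ t, tailKernel M (t / y) ∂(μ : Measure ℝ)

lemma min_pow_mem_Icc {s : ℝ} (hs : 0 ≤ s) (k : ℕ) : min s 1 ^ k ∈ Icc (0 : ℝ) 1 := by
  have h0 : 0 ≤ min s 1 := le_min hs zero_le_one
  exact ⟨by positivity, pow_le_one₀ h0 (min_le_right _ _)⟩

lemma tailKernel_of_one_le {s : ℝ} (hs : 1 ≤ s) (M : ℕ) : tailKernel M s = 1 := by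
  simp [tailKernel, min_eq_right hs]

lemma min_pow_le_tailKernel {s : ℝ} (hs : 0 ≤ s) (M : ℕ) : min s 1 ^ M ≤ tailKernel M s := by
  obtain ⟨h0, h1⟩ := min_pow_mem_Icc hs M
  unfold tailKernel; nlinarith

lemma tailKernel_le {s : ℝ} (hs : 0 ≤ s) (M : ℕ) : tailKernel M s ≤ 2 * min s 1 ^ M := by
  obtain ⟨h0, h1⟩ := min_pow_mem_Icc hs M
  unfold tailKernel; nlinarith

lemma tailKernel_mem_Icc {s : ℝ} (hs : 0 ≤ s) (M : ℕ) : tailKernel M s ∈ Icc (0 : ℝ) 1 := by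
  refine ⟨(min_pow_mem_Icc hs M).1.trans (min_pow_le_tailKernel hs M), ?_⟩
  unfold tailKernel; nlinarith [sq_nonneg (1 - min s 1 ^ M)]

lemma indicator_le_tailKernel {s : ℝ} (hs : 0 ≤ s) (M : ℕ) :
    (Ioi (1 : ℝ)).indicator 1 s ≤ tailKernel M s := by
  by_cases h : 1 < s
  · rw [indicator_of_mem (mem_Ioi.2 h), tailKernel_of_one_le h.le]; simp
  · rw [indicator_of_notMem (by simpa using h)]; exact (tailKernel_mem_Icc hs M).1

lemma tailKernel_le_indicator_add {s q : ℝ} (hs : 0 ≤ s) (hq0 : 0 < q) (hq1 : q ≤ 1) {K M : ℕ}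
    (hKM : K ≤ M) :
    tailKernel M s ≤ (Ioi q).indicator 1 s + 2 * q ^ M * min (s / q) 1 ^ K := by
  have h0 := (min_pow_mem_Icc (div_nonneg hs hq0.le) K).1
  by_cases h : q < s
  · rw [indicator_of_mem (mem_Ioi.2 h)]
    have := (tailKernel_mem_Icc hs M).2
    have : 0 ≤ 2 * q ^ M * min (s / q) 1 ^ K := by positivity
    simp only [Pi.one_apply]; linarith
  · rw [indicator_of_notMem (by simpa using h), zero_add]
    push Not at h
    have h1 : s / q ≤ 1 := (div_le_one hq0).2 h
    have hsq : 0 ≤ s / q := by positivity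
    refine (tailKernel_le hs M).trans ?_
    rw [min_eq_left (h.trans hq1), min_eq_left h1]
    calc 2 * s ^ M = 2 * q ^ M * (s / q) ^ M := by rw [div_pow]; field_simp
      _ ≤ 2 * q ^ M * (s / q) ^ K :=
        mul_le_mul_of_nonneg_left (pow_le_pow_of_le_one hsq h1 hKM) (by positivity)

section
variable {μ : ProbabilityMeasure ℝ} (hμ : SupportedOnNonneg μ)
include hμ

lemma integrable_truncMoment (k : ℕ) {y : ℝ} (hy : 0 < y) :
    Integrable (fun t => min (t / y) 1 ^ k) (μ : Measure ℝ) := by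
  refine Integrable.of_bound (by fun_prop) 1 ?_
  filter_upwards [hμ.ae_nonneg] with t ht
  obtain ⟨h0, h1⟩ := min_pow_mem_Icc (div_nonneg ht hy.le) k
  rw [Real.norm_eq_abs, abs_of_nonneg h0]; exact h1

lemma integrable_smoothTail (M : ℕ) {y : ℝ} (hy : 0 < y) :
    Integrable (fun t => tailKernel M (t / y)) (μ : Measure ℝ) := by
  refine Integrable.of_bound (by unfold tailKernel; fun_prop) 1 ?_
  filter_upwards [hμ.ae_nonneg] with t ht
  obtain ⟨h0, h1⟩ := tailKernel_mem_Icc (div_nonneg ht hy.le) M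
  rw [Real.norm_eq_abs, abs_of_nonneg h0]; exact h1

lemma truncMoment_nonneg (k : ℕ) {y : ℝ} (hy : 0 < y) : 0 ≤ truncMoment μ k y := by
  refine integral_nonneg_of_ae ?_
  filter_upwards [hμ.ae_nonneg] with t ht
  exact (min_pow_mem_Icc (div_nonneg ht hy.le) k).1

lemma truncMoment_le_one (k : ℕ) {y : ℝ} (hy : 0 < y) : truncMoment μ k y ≤ 1 := by
  have : ∫ _, (1 : ℝ) ∂(μ : Measure ℝ) = 1 := by simp
  rw [← this]
  refine integral_mono_ae (integrable_truncMoment hμ k hy) (integrable_const _) ?_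
  filter_upwards [hμ.ae_nonneg] with t ht
  exact (min_pow_mem_Icc (div_nonneg ht hy.le) k).2

omit hμ in
lemma integral_indicator_Ioi_div (μ : ProbabilityMeasure ℝ) {y : ℝ} (hy : 0 < y) (q : ℝ) :
    Integrable (fun t => (Ioi q).indicator (1 : ℝ → ℝ) (t / y)) (μ : Measure ℝ) ∧
    ∫ t, (Ioi q).indicator (1 : ℝ → ℝ) (t / y) ∂(μ : Measure ℝ) = measureTail μ (y * q) := by
  have : (fun t => (Ioi q).indicator (1 : ℝ → ℝ) (t / y)) = (Ioi (y * q)).indicator 1 := by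
    funext t
    simp only [indicator, mem_Ioi, lt_div_iff₀ hy, mul_comm]
    rfl
  rw [this]
  exact ⟨(integrable_const (1 : ℝ)).indicator measurableSet_Ioi,
    integral_indicator_one measurableSet_Ioi⟩

lemma measureTail_le_truncMoment (k : ℕ) {y : ℝ} (hy : 0 < y) :
    measureTail μ y ≤ truncMoment μ k y := by
  obtain ⟨hi, he⟩ := integral_indicator_Ioi_div μ hy 1
  rw [mul_one] at he
  rw [← he]
  refine integral_mono_ae hi (integrable_truncMoment hμ k hy) ?_
  filter_upwards [hμ.ae_nonneg] with t ht
  by_cases h : 1 < t / y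
  · simp [indicator_of_mem (mem_Ioi.2 h), min_eq_right h.le]
  · rw [indicator_of_notMem (by simpa using h)]
    exact (min_pow_mem_Icc (div_nonneg ht hy.le) k).1

lemma measureTail_le_smoothTail (M : ℕ) {y : ℝ} (hy : 0 < y) :
    measureTail μ y ≤ smoothTail μ M y := by
  obtain ⟨hi, he⟩ := integral_indicator_Ioi_div μ hy 1
  rw [mul_one] at he
  rw [← he]
  refine integral_mono_ae hi (integrable_smoothTail hμ M hy) ?_
  filter_upwards [hμ.ae_nonneg] with t ht
  exact indicator_le_tailKernel (div_nonneg ht hy.le) M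

lemma truncMoment_le_smoothTail (M : ℕ) {y : ℝ} (hy : 0 < y) :
    truncMoment μ M y ≤ smoothTail μ M y := by
  refine integral_mono_ae (integrable_truncMoment hμ M hy) (integrable_smoothTail hμ M hy) ?_
  filter_upwards [hμ.ae_nonneg] with t ht
  exact min_pow_le_tailKernel (div_nonneg ht hy.le) M

lemma smoothTail_le_truncMoment (M : ℕ) {y : ℝ} (hy : 0 < y) :
    smoothTail μ M y ≤ 2 * truncMoment μ M y := by
  rw [truncMoment, ← integral_const_mul]
  refine integral_mono_ae (integrable_smoothTail hμ M hy)
    ((integrable_truncMoment hμ M hy).const_mul 2) ?_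
  filter_upwards [hμ.ae_nonneg] with t ht
  exact tailKernel_le (div_nonneg ht hy.le) M

lemma smoothTail_le_measureTail_add {K M : ℕ} (hKM : K ≤ M) {y q : ℝ} (hy : 0 < y) (hq0 : 0 < q)
    (hq1 : q ≤ 1) :
    smoothTail μ M y ≤ measureTail μ (y * q) + 2 * q ^ M * truncMoment μ K (y * q) := by
  obtain ⟨hi, he⟩ := integral_indicator_Ioi_div μ hy q
  have hi2 := (integrable_truncMoment hμ K (mul_pos hy hq0)).const_mul (2 * q ^ M)
  rw [← he, truncMoment, ← integral_const_mul, ← integral_add hi hi2]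
  refine integral_mono_ae (integrable_smoothTail hμ M hy) (hi.add hi2) ?_
  filter_upwards [hμ.ae_nonneg] with t ht
  have := tailKernel_le_indicator_add (div_nonneg ht hy.le) hq0 hq1 hKM
  rwa [div_div] at this

lemma truncMoment_two_mul_le (N : ℕ) {y : ℝ} (hy : 0 < y) :
    truncMoment μ N (2 * y) ≤ (1 / 2) ^ N * truncMoment μ N y + measureTail μ y := by
  obtain ⟨hi, he⟩ := integral_indicator_Ioi_div μ hy 1
  rw [mul_one] at he
  have hi2 := (integrable_truncMoment hμ N hy).const_mul ((1 / 2) ^ N)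
  rw [← he, truncMoment, truncMoment, ← integral_const_mul, ← integral_add hi2 hi]
  refine integral_mono_ae (integrable_truncMoment hμ N (by positivity)) (hi2.add hi) ?_
  filter_upwards [hμ.ae_nonneg] with t ht
  by_cases h : 1 < t / y
  · have h1 := (min_pow_mem_Icc (div_nonneg ht (by positivity : 0 ≤ 2 * y)) N).2
    have h2 := (min_pow_mem_Icc (div_nonneg ht hy.le) N).1
    rw [indicator_of_mem (mem_Ioi.2 h)]
    have : 0 ≤ (1 / 2 : ℝ) ^ N * min (t / y) 1 ^ N := by positivity
    simp only [Pi.one_apply]; linarith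
  · rw [indicator_of_notMem (by simpa using h), add_zero]
    push Not at h
    have h3 : t / (2 * y) = 1 / 2 * (t / y) := by field_simp
    rw [min_eq_left h, h3, min_eq_left (by linarith), mul_pow]

/-- A Karamata-type bound: the truncated moment of order `N > α` is of the order of the tail. It
propagates from one dyadic scale to the next. -/
lemma exists_truncMoment_le {α : ℝ} (hreg : RegularlyVarying (measureTail μ) (-α)) {N : ℕ}
    (hN : α < N) :
    ∃ C : ℝ, 0 < C ∧ ∀ᶠ y in atTop, truncMoment μ N y ≤ C * measureTail μ y := by
  have hpos := measureTail_pos hreg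
  have hlt : (1 / 2 : ℝ) ^ N < 2 ^ (-α) := by
    rw [one_div, inv_pow, ← Real.rpow_natCast, ← Real.rpow_neg (by norm_num)]
    exact Real.rpow_lt_rpow_of_exponent_lt (by norm_num) (by linarith)
  obtain ⟨L, hL1, hL2⟩ := exists_between hlt
  have hL0 : 0 < L := lt_trans (by positivity) hL1
  obtain ⟨x₁, hx₁⟩ := eventually_atTop.1 ((hreg.2 2 two_pos).eventually (lt_mem_nhds hL2))
  set x₀ := max x₁ 1 with hx₀
  have hx0 : 0 < x₀ := lt_of_lt_of_le one_pos (le_max_right _ _)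
  -- the first term of the maximum covers `[x₀, 2 x₀]`, the second one makes doubling preserve the bound
  set C := max (1 / measureTail μ (2 * x₀)) (1 / (L - (1 / 2) ^ N)) with hC
  have hCpos : 0 < C := lt_of_lt_of_le (one_div_pos.2 (hpos _)) (le_max_left _ _)
  refine ⟨C, hCpos, ?_⟩
  have key : ∀ n : ℕ, ∀ y, x₀ ≤ y → y ≤ 2 ^ n * x₀ → truncMoment μ N y ≤ C * measureTail μ y := by
    intro n
    induction n with
    | zero =>
      intro y hy hy2
      have hC1 : 1 ≤ C * measureTail μ (2 * x₀) := by
        rw [← div_le_iff₀ (hpos _)]; exact le_max_left _ _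
      have : measureTail μ (2 * x₀) ≤ measureTail μ y :=
        measureTail_antitone μ (by simp at hy2; linarith)
      have h1 := truncMoment_le_one hμ N (hx0.trans_le hy)
      nlinarith
    | succ n ih =>
      intro y hy hy2
      rcases le_or_gt y (2 * x₀) with h | h
      · have hC1 : 1 ≤ C * measureTail μ (2 * x₀) := by
          rw [← div_le_iff₀ (hpos _)]; exact le_max_left _ _
        have : measureTail μ (2 * x₀) ≤ measureTail μ y := measureTail_antitone μ h
        have h1 := truncMoment_le_one hμ N (hx0.trans_le hy)
        nlinarith
      · have hyh : x₀ ≤ y / 2 := by linarith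
        have h1 := ih (y / 2) hyh (by rw [pow_succ] at hy2; linarith)
        have h2 := truncMoment_two_mul_le hμ N (hx0.trans_le hyh)
        have h3 := hx₁ (y / 2) ((le_max_left _ _).trans hyh)
        rw [show 2 * (y / 2) = y by ring] at h2 h3
        rw [lt_div_iff₀ (hpos _)] at h3
        have h4 : 1 ≤ C * (L - (1 / 2) ^ N) := by
          rw [← div_le_iff₀ (by linarith)]; exact le_max_right _ _
        have h5 := hpos (y / 2)
        have h6 : (0 : ℝ) < (1 / 2) ^ N := by positivity
        calc _ ≤ _ := h2
          _ ≤ (1 / 2) ^ N * (C * measureTail μ (y / 2)) + measureTail μ (y / 2) := by gcongr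
          _ = ((1 / 2) ^ N * C + 1) * measureTail μ (y / 2) := by ring
          _ ≤ (C * L) * measureTail μ (y / 2) := by gcongr; linarith
          _ = C * (L * measureTail μ (y / 2)) := by ring
          _ ≤ _ := by gcongr
  filter_upwards [eventually_ge_atTop x₀] with y hy
  obtain ⟨n, hn⟩ := pow_unbounded_of_one_lt (y / x₀) (one_lt_two : (1 : ℝ) < 2)
  exact key n y hy ((div_lt_iff₀ hx0).1 hn).le

lemma tendsto_truncMoment_one : Tendsto (truncMoment μ 1) atTop (𝓝 0) := by
  have : (0 : ℝ) = ∫ _, (0 : ℝ) ∂(μ : Measure ℝ) := by simp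
  rw [this]
  refine tendsto_integral_filter_of_dominated_convergence (fun _ => (1 : ℝ))
    (Eventually.of_forall fun y => by fun_prop) ?_ (integrable_const _) ?_
  · filter_upwards [eventually_gt_atTop 0] with y hy
    filter_upwards [hμ.ae_nonneg] with t ht
    obtain ⟨h0, h1⟩ := min_pow_mem_Icc (div_nonneg ht hy.le) 1
    rw [Real.norm_eq_abs, abs_of_nonneg h0]; exact h1
  · refine ae_of_all _ fun t => ?_
    have h1 : Tendsto (fun y : ℝ => t / y) atTop (𝓝 0) := tendsto_const_nhds.div_atTop tendsto_id
    have h2 := (h1.min (tendsto_const_nhds (x := (1 : ℝ)))).pow 1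
    simpa using h2

end

lemma psiTransform_map_div (μ : Measure ℝ) {y : ℝ} (w : ℂ) :
    psiTransform (μ.map (· / y)) w = psiTransform μ (w / y) := by
  unfold psiTransform
  rw [integral_map (φ := (· / y)) (f := fun t => psiKernel t w) (by fun_prop)
    (measurable_psiKernel.comp (measurable_id.prodMk measurable_const)).aestronglyMeasurable]
  refine integral_congr_ae (ae_of_all _ fun t => ?_)
  simp only [psiKernel]; push_cast
  rw [div_mul_eq_mul_div, mul_div_assoc]

/-- The comparison at scale `1`, applied to the rescaled measures. -/
lemma isLittleO_smoothTail_sub {μ ρ : ProbabilityMeasure ℝ} (hμ : SupportedOnNonneg μ)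
    (hρ : SupportedOnNonneg ρ) {α : ℝ} (hreg : RegularlyVarying (measureTail μ) (-α)) {n : ℕ}
    (hn : 1 ≤ n) (hrel : ∀ w : ℂ, w.im ≠ 0 → psiTransform (ρ : Measure ℝ) w
      = n * psiTransform (μ : Measure ℝ) w
        + (n - 1) * psiTransform (μ : Measure ℝ) w * psiTransform (ρ : Measure ℝ) w)
    {N : ℕ} (hN : 1 ≤ N) (hNα : α < N) {δ : ℝ} (hδ : 0 < δ) :
    ∀ᶠ y in atTop, |smoothTail ρ (N + 1) y - n * smoothTail μ (N + 1) y|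
      ≤ δ * measureTail μ y := by
  obtain ⟨C, r, hC, hr, hcore⟩ := exists_abs_integral_tailKernel_sub_le hN hn
  obtain ⟨C', hC', hK⟩ := exists_truncMoment_le hμ hreg hNα
  have hN0 : (N : ℝ) ≠ 0 := by positivity
  have hT0 : Tendsto (truncMoment μ N) atTop (𝓝 0) := by
    have h1 : Tendsto (fun y => C' * measureTail μ y) atTop (𝓝 0) := by
      simpa using (tendsto_measureTail μ).const_mul C'
    refine tendsto_of_tendsto_of_tendsto_of_le_of_le' tendsto_const_nhds h1 ?_ hK
    filter_upwards [eventually_gt_atTop 0] with y hy using truncMoment_nonneg hμ N hy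
  have hb0 : Tendsto (fun y => truncMoment μ N y ^ (1 / (N : ℝ))) atTop (𝓝 0) := by
    have := hT0.rpow_const (p := 1 / (N : ℝ)) (Or.inr (by positivity))
    rwa [Real.zero_rpow (by positivity)] at this
  have hsmall : Tendsto (fun y => C * C' * (truncMoment μ N y ^ (1 / (N : ℝ)) + truncMoment ρ 1 y))
      atTop (𝓝 0) := by
    simpa using (hb0.add (tendsto_truncMoment_one hρ)).const_mul (C * C')
  filter_upwards [hK, eventually_gt_atTop 0, hb0.eventually (gt_mem_nhds hr),
    hsmall.eventually (gt_mem_nhds hδ)] with y hKy hy hby hsy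
  set b := truncMoment μ N y ^ (1 / (N : ℝ)) with hb
  have hTpos : 0 < truncMoment μ N y :=
    (measureTail_pos hreg y).trans_le (measureTail_le_truncMoment hμ N hy)
  have hbpos : 0 < b := Real.rpow_pos_of_pos hTpos _
  have hbN : b ^ N = truncMoment μ N y := by
    rw [hb, ← Real.rpow_natCast, ← Real.rpow_mul hTpos.le, one_div_mul_cancel hN0, Real.rpow_one]
  have hm : Measurable (fun t : ℝ => t / y) := by fun_prop
  have h1 : IsProbabilityMeasure ((μ : Measure ℝ).map (· / y)) :=
    Measure.isProbabilityMeasure_map hm.aemeasurable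
  have h2 : IsProbabilityMeasure ((ρ : Measure ℝ).map (· / y)) :=
    Measure.isProbabilityMeasure_map hm.aemeasurable
  have hnn : ∀ ν : ProbabilityMeasure ℝ, SupportedOnNonneg ν →
      ∀ᵐ t ∂((ν : Measure ℝ).map (· / y)), 0 ≤ t := by
    intro ν hν
    rw [ae_map_iff hm.aemeasurable measurableSet_Ici]
    filter_upwards [hν.ae_nonneg] with t ht
    exact div_nonneg ht hy.le
  have hint : ∀ (ν : ProbabilityMeasure ℝ) (f : ℝ → ℝ), Measurable f →
      ∫ t, f t ∂((ν : Measure ℝ).map (· / y)) = ∫ t, f (t / y) ∂(ν : Measure ℝ) :=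
    fun ν f hf => integral_map hm.aemeasurable hf.aestronglyMeasurable
  have hmk : Measurable (tailKernel (N + 1)) := by unfold tailKernel; fun_prop
  have := hcore _ _ (hnn μ hμ) (hnn ρ hρ) (fun w hw => by
    simp only [psiTransform_map_div]
    refine hrel _ ?_
    rw [Complex.div_ofReal_im]
    exact div_ne_zero hw hy.ne') b hbpos hby.le (by
      rw [hint μ (fun t => min t 1 ^ N) (by fun_prop), hbN]; rfl)
  rw [hint ρ _ hmk, hint μ _ hmk, hint ρ (fun t => min t 1) (by fun_prop), hbN] at this
  have e : ∫ t, min (t / y) 1 ∂(ρ : Measure ℝ) = truncMoment ρ 1 y := by simp [truncMoment]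
  rw [e] at this
  have h1n := truncMoment_nonneg hρ 1 hy
  refine this.trans ?_
  calc _ ≤ C * (C' * measureTail μ y) * (b + truncMoment ρ 1 y) := by gcongr
    _ = (C * C' * (b + truncMoment ρ 1 y)) * measureTail μ y := by ring
    _ ≤ _ := by gcongr; exact measureTail_nonneg μ y

/-! ### From smoothed tails to tails -/

theorem isEquivalent_measureTail {μ ρ : ProbabilityMeasure ℝ} (hμ : SupportedOnNonneg μ)
    (hρ : SupportedOnNonneg ρ) {α : ℝ}
    (hreg : RegularlyVarying (measureTail μ) (-α)) {n : ℕ} (hn : 1 ≤ n)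
    (hrel : ∀ w : ℂ, w.im ≠ 0 → psiTransform (ρ : Measure ℝ) w
      = n * psiTransform (μ : Measure ℝ) w
        + (n - 1) * psiTransform (μ : Measure ℝ) w * psiTransform (ρ : Measure ℝ) w) :
    measureTail ρ ~[atTop] fun y => (n : ℝ) * measureTail μ y := by
  have hpos := measureTail_pos hreg
  have hn0 : (1 : ℝ) ≤ n := by exact_mod_cast hn
  obtain ⟨K, hK⟩ := exists_nat_gt (max α 1)
  have hKα : α < K := (le_max_left _ _).trans_lt hK
  have hK1 : 1 ≤ K := by exact_mod_cast ((le_max_right _ _).trans_lt hK).le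
  obtain ⟨C₀, hC₀, hμK⟩ := exists_truncMoment_le hμ hreg (N := K + 1) (by push_cast; linarith)
  set C := 2 * n * C₀ + 1 with hC
  have hμC : ∀ᶠ y in atTop, truncMoment μ (K + 1) y ≤ C * measureTail μ y := by
    filter_upwards [hμK] with y hy
    refine hy.trans ?_
    have := (hpos y).le
    gcongr
    nlinarith
  have hρC : ∀ᶠ y in atTop, truncMoment ρ (K + 1) y ≤ C * measureTail μ y := by
    filter_upwards [hμK, eventually_gt_atTop 0,
      isLittleO_smoothTail_sub hμ hρ hreg hn hrel hK1 hKα one_pos] with y hy hy0 hd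
    have h1 := truncMoment_le_smoothTail hρ (K + 1) hy0
    have h2 := smoothTail_le_truncMoment hμ (K + 1) hy0
    have h3 := (abs_le.1 hd).2
    have h4 : n * smoothTail μ (K + 1) y ≤ n * (2 * (C₀ * measureTail μ y)) := by
      gcongr; linarith
    rw [hC]; linarith
  refine IsLittleO.of_bound fun ε hε => ?_
  have hε4 : 0 < ε / 4 := by linarith
  -- a ratio `q < 1` so close to `1` that rescaling by `q` hardly changes the tail
  obtain ⟨q, ⟨hq1, hq2⟩, hq3, hq4⟩ : ∃ q : ℝ, (n * q ^ (-α) < n + ε / 2 ∧ n - ε / 2 < n * q ^ α) ∧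
      0 < q ∧ q < 1 := by
    have c1 : Tendsto (fun q : ℝ => n * q ^ (-α)) (𝓝[<] 1) (𝓝 (n * 1 ^ (-α))) :=
      ((Real.continuousAt_rpow_const 1 (-α) (Or.inl one_ne_zero)).const_mul _).tendsto.mono_left
        nhdsWithin_le_nhds
    have c2 : Tendsto (fun q : ℝ => n * q ^ α) (𝓝[<] 1) (𝓝 (n * 1 ^ α)) :=
      ((Real.continuousAt_rpow_const 1 α (Or.inl one_ne_zero)).const_mul _).tendsto.mono_left
        nhdsWithin_le_nhds
    rw [Real.one_rpow, mul_one] at c1 c2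
    have c3 : ∀ᶠ q : ℝ in 𝓝[<] 1, 0 < q ∧ q < 1 := Ioo_mem_nhdsLT zero_lt_one
    exact (((c1.eventually (gt_mem_nhds (by linarith))).and
      (c2.eventually (lt_mem_nhds (by linarith)))).and c3).exists
  obtain ⟨M, ⟨hM1, hM2⟩, hM3⟩ : ∃ M : ℕ, (n * (1 + 2 * q ^ M * C) * q ^ (-α) < n + ε / 2 ∧
      2 * q ^ M * C < ε / 4) ∧ K + 1 ≤ M := by
    have c0 := tendsto_pow_atTop_nhds_zero_of_lt_one hq3.le hq4
    have c1 : Tendsto (fun M : ℕ => 2 * q ^ M * C) atTop (𝓝 0) := by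
      simpa using (c0.const_mul 2).mul_const C
    have c2 : Tendsto (fun M : ℕ => n * (1 + 2 * q ^ M * C) * q ^ (-α)) atTop
        (𝓝 (n * q ^ (-α))) := by
      simpa using ((c1.const_add 1).const_mul (n : ℝ)).mul_const (q ^ (-α))
    exact (((c2.eventually (gt_mem_nhds hq1)).and (c1.eventually (gt_mem_nhds hε4))).and
      (eventually_ge_atTop (K + 1))).exists
  obtain ⟨N, rfl⟩ : ∃ N, M = N + 1 := ⟨M - 1, by omega⟩
  have hNα : α < N := hKα.trans_le (by exact_mod_cast (by omega : K ≤ N))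
  have hd := isLittleO_smoothTail_sub hμ hρ hreg hn hrel (N := N) (by omega) hNα hε4
  have hqi : Tendsto (fun y => y * q) atTop atTop := tendsto_id.atTop_mul_const hq3
  have hqi' : Tendsto (fun y => y / q) atTop atTop := tendsto_id.atTop_div_const hq3
  have hup : ∀ᶠ y in atTop, n * (1 + 2 * q ^ (N + 1) * C) * (measureTail μ (q * y) / measureTail μ y)
      < n + ε / 2 :=
    ((hreg.2 q hq3).const_mul _).eventually (gt_mem_nhds hM1)
  have hlow : ∀ᶠ y in atTop, n - ε / 2 < n * (measureTail μ (q⁻¹ * y) / measureTail μ y) := by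
    refine ((hreg.2 q⁻¹ (inv_pos.2 hq3)).const_mul _).eventually (lt_mem_nhds ?_)
    rwa [Real.inv_rpow hq3.le, Real.rpow_neg hq3.le, inv_inv]
  filter_upwards [hd, hup, hlow, eventually_gt_atTop 0, hqi.eventually hμC, hρC,
    hqi'.eventually hd] with y hdy hupy hlowy hy hμCy hρCy hdy'
  have hτ := hpos y
  rw [← mul_div_assoc, div_lt_iff₀ hτ, mul_comm q y] at hupy
  rw [← mul_div_assoc, lt_div_iff₀ hτ, mul_comm q⁻¹ y, ← div_eq_mul_inv] at hlowy
  have hyq : 0 < y / q := by positivity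
  have hyqq : y / q * q = y := by field_simp
  simp only [Pi.sub_apply, Real.norm_eq_abs]
  rw [abs_of_pos (by positivity : 0 < n * measureTail μ y), abs_le]
  have hqM : 0 ≤ 2 * q ^ (N + 1) := by positivity
  have hετ : ε * measureTail μ y ≤ ε * (n * measureTail μ y) := by
    gcongr; nlinarith
  have hετ0 : 0 < ε * measureTail μ y := by positivity
  constructor
  · have h1 := measureTail_le_smoothTail hμ (N + 1) hyq
    have h2 := smoothTail_le_measureTail_add hρ hM3 hyq hq3 hq4.le
    rw [hyqq] at h2
    have h3 := (abs_le.1 hdy').1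
    have h4 : measureTail μ (y / q) ≤ measureTail μ y :=
      measureTail_antitone μ ((le_div_iff₀ hq3).2 (by nlinarith))
    have h5 : 2 * q ^ (N + 1) * truncMoment ρ (K + 1) y
        ≤ 2 * q ^ (N + 1) * (C * measureTail μ y) := by gcongr
    have h6 : 2 * q ^ (N + 1) * C * measureTail μ y ≤ ε / 4 * measureTail μ y := by gcongr
    have h7 : n * measureTail μ (y / q) ≤ n * smoothTail μ (N + 1) (y / q) := by gcongr
    have h8 : ε / 4 * measureTail μ (y / q) ≤ ε / 4 * measureTail μ y := by gcongr
    linarith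
  · have h1 := measureTail_le_smoothTail hρ (N + 1) hy
    have h2 := smoothTail_le_measureTail_add hμ hM3 hy hq3 hq4.le
    have h3 := (abs_le.1 hdy).2
    have h5 : 2 * q ^ (N + 1) * truncMoment μ (K + 1) (y * q)
        ≤ 2 * q ^ (N + 1) * (C * measureTail μ (y * q)) := by gcongr
    have h7 : n * smoothTail μ (N + 1) y ≤ n * (measureTail μ (y * q)
        + 2 * q ^ (N + 1) * (C * measureTail μ (y * q))) := by gcongr; linarith
    have h8 : n * (measureTail μ (y * q) + 2 * q ^ (N + 1) * (C * measureTail μ (y * q)))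
        = n * (1 + 2 * q ^ (N + 1) * C) * measureTail μ (y * q) := by ring
    linarith

/-! ### The Cauchy transform and the transform `ψ` -/

lemma sub_ofReal_ne_zero {z : ℂ} (hz : z.im ≠ 0) (t : ℝ) : z - (t : ℂ) ≠ 0 := by
  intro h; apply hz; have := congrArg Complex.im h; simpa using this

lemma abs_im_le_norm_sub_ofReal (z : ℂ) (t : ℝ) : |z.im| ≤ ‖z - (t : ℂ)‖ := by
  have := Complex.abs_im_le_norm (z - (t : ℂ)); simpa using this

lemma norm_inv_sub_ofReal_le {z : ℂ} (hz : z.im ≠ 0) (t : ℝ) : ‖1 / (z - (t : ℂ))‖ ≤ 1 / |z.im| := by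
  rw [norm_div, norm_one]
  exact one_div_le_one_div_of_le (abs_pos.2 hz) (abs_im_le_norm_sub_ofReal z t)

lemma integrable_inv_sub (μ : Measure ℝ) [IsFiniteMeasure μ] {z : ℂ} (hz : z.im ≠ 0) :
    Integrable (fun t : ℝ => 1 / (z - (t : ℂ))) μ :=
  Integrable.of_bound (Measurable.aestronglyMeasurable (by fun_prop)) (1 / |z.im|)
    (ae_of_all _ fun t => norm_inv_sub_ofReal_le hz t)

lemma im_inv_sub (z : ℂ) (t : ℝ) :
    (1 / (z - (t : ℂ))).im = -z.im / ((z.re - t) ^ 2 + z.im ^ 2) := by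
  rw [one_div, Complex.inv_im, Complex.normSq_apply]
  simp [sq]

lemma im_cauchyTransform (μ : ProbabilityMeasure ℝ) {z : ℂ} (hz : z.im ≠ 0) :
    (cauchyTransform μ z).im = ∫ t, -z.im / ((z.re - t) ^ 2 + z.im ^ 2) ∂(μ : Measure ℝ) := by
  have := integral_im (integrable_inv_sub (μ : Measure ℝ) hz)
  simp only [RCLike.im_to_complex, im_inv_sub] at this
  exact this.symm

lemma integrable_poisson (μ : Measure ℝ) [IsFiniteMeasure μ] {z : ℂ} (hz : z.im ≠ 0) :
    Integrable (fun t : ℝ => -z.im / ((z.re - t) ^ 2 + z.im ^ 2)) μ := by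
  have := (integrable_inv_sub μ hz).im
  simpa only [RCLike.im_to_complex, im_inv_sub] using this

lemma im_cauchyTransform_neg (μ : ProbabilityMeasure ℝ) {z : ℂ} (hz : 0 < z.im) :
    (cauchyTransform μ z).im < 0 := by
  rw [im_cauchyTransform μ hz.ne', ← neg_pos, ← integral_neg]
  refine (integral_pos_iff_support_of_nonneg (fun t => ?_)
    (integrable_poisson (μ : Measure ℝ) hz.ne').neg).2 ?_
  · have : 0 < (z.re - t) ^ 2 + z.im ^ 2 := by positivity
    simp only [Pi.zero_apply, Pi.neg_apply, neg_div, neg_neg]; positivity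
  · have : Function.support (-fun t : ℝ => -z.im / ((z.re - t) ^ 2 + z.im ^ 2)) = univ := by
      ext t
      have : 0 < (z.re - t) ^ 2 + z.im ^ 2 := by positivity
      simp only [Pi.neg_apply, neg_div, neg_neg, Function.mem_support, mem_univ, iff_true]
      positivity
    rw [this]; simp

lemma cauchyTransform_ne_zero (μ : ProbabilityMeasure ℝ) {z : ℂ} (hz : 0 < z.im) :
    cauchyTransform μ z ≠ 0 := by
  intro h
  have := im_cauchyTransform_neg μ hz
  rw [h] at this; simp at this

lemma psiKernel_inv {z : ℂ} (hz : z.im ≠ 0) (t : ℝ) : psiKernel t z⁻¹ = z * (1 / (z - t)) - 1 := by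
  have h1 := sub_ofReal_ne_zero hz t
  have h2 : z ≠ 0 := by rintro rfl; simp at hz
  unfold psiKernel; field_simp; ring

lemma psiTransform_inv (μ : ProbabilityMeasure ℝ) {z : ℂ} (hz : z.im ≠ 0) :
    psiTransform (μ : Measure ℝ) z⁻¹ = z * cauchyTransform μ z - 1 := by
  unfold psiTransform cauchyTransform
  simp_rw [psiKernel_inv hz]
  rw [integral_sub ((integrable_inv_sub _ hz).const_mul z) (integrable_const _), integral_const_mul]
  simp

lemma psiTransform_conj (μ : Measure ℝ) (w : ℂ) :
    psiTransform μ (starRingEnd ℂ w) = starRingEnd ℂ (psiTransform μ w) := by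
  unfold psiTransform
  rw [← integral_conj]
  refine integral_congr_ae (ae_of_all _ fun t => ?_)
  simp [psiKernel]

/-- The relation `K_ρ = n K_μ`, cleared of denominators. -/
lemma booleanK_eq_nat_mul_iff {μ ρ : ProbabilityMeasure ℝ} {z : ℂ} (hz : 0 < z.im) (n : ℕ) :
    booleanK ρ z = n * booleanK μ z ↔
      cauchyTransform ρ z * (n - (n - 1) * z * cauchyTransform μ z) = cauchyTransform μ z := by
  have h1 := cauchyTransform_ne_zero μ hz
  have h2 := cauchyTransform_ne_zero ρ hz
  unfold booleanK
  generalize cauchyTransform μ z = g at *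
  generalize cauchyTransform ρ z = r at *
  field_simp
  constructor <;> intro h <;> linear_combination h

lemma psiTransform_eq_of_booleanK {μ ρ : ProbabilityMeasure ℝ} {n : ℕ}
    (h : ∀ z : ℂ, 0 < z.im → booleanK ρ z = n * booleanK μ z) (w : ℂ) (hw : w.im ≠ 0) :
    psiTransform (ρ : Measure ℝ) w = n * psiTransform (μ : Measure ℝ) w
      + (n - 1) * psiTransform (μ : Measure ℝ) w * psiTransform (ρ : Measure ℝ) w := by
  have key : ∀ z : ℂ, 0 < z.im → psiTransform (ρ : Measure ℝ) z⁻¹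
      = n * psiTransform (μ : Measure ℝ) z⁻¹
      + (n - 1) * psiTransform (μ : Measure ℝ) z⁻¹ * psiTransform (ρ : Measure ℝ) z⁻¹ := by
    intro z hz
    have := (booleanK_eq_nat_mul_iff hz n).1 (h z hz)
    rw [psiTransform_inv μ hz.ne', psiTransform_inv ρ hz.ne']
    linear_combination z * this
  have hw0 : w ≠ 0 := by rintro rfl; simp at hw
  have hN : 0 < Complex.normSq w := Complex.normSq_pos.2 hw0
  rcases lt_or_gt_of_ne hw with hneg | hpos
  · have := key w⁻¹ (by rw [Complex.inv_im]; exact div_pos (by linarith) hN)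
    rwa [inv_inv] at this
  · have := key (starRingEnd ℂ w)⁻¹ (by
      rw [Complex.inv_im, Complex.normSq_conj, Complex.conj_im, neg_neg]; exact div_pos hpos hN)
    rw [inv_inv] at this
    simp only [psiTransform_conj] at this
    have h2 := congrArg (starRingEnd ℂ) this
    simpa using h2

lemma IsBooleanPower.booleanK_eq {μ ρ : ProbabilityMeasure ℝ} {n : ℕ} (h : IsBooleanPower μ n ρ) :
    ∀ z : ℂ, 0 < z.im → booleanK ρ z = n * booleanK μ z := by
  induction h with
  | one => intro z _; simp
  | succ _ hconv ih =>
    intro z hz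
    rw [hconv z hz, ih z hz]; push_cast; ring

/-! ### Boolean powers of a measure on the half-line live on the half-line -/

section
variable {μ : ProbabilityMeasure ℝ} (hμ : SupportedOnNonneg μ)
include hμ

lemma neg_im_cauchyTransform_le {ρ : ProbabilityMeasure ℝ} {n : ℕ} (hn : 1 ≤ n)
    (h : ∀ z : ℂ, 0 < z.im → booleanK ρ z = n * booleanK μ z) {b : ℝ} (hb : b < 0) {z : ℂ}
    (hz : 0 < z.im) (hzb : z.re ≤ b) :
    -(cauchyTransform ρ z).im ≤ n / b ^ 2 * z.im := by
  have hb2 : 0 < b ^ 2 := sq_pos_iff.2 hb.ne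
  have hc : (0 : ℝ) ≤ n - 1 := by
    have : (1 : ℝ) ≤ n := by exact_mod_cast hn
    linarith
  set c : ℝ := n - 1 with hcdef
  set m := psiTransform (μ : Measure ℝ) z⁻¹ with hm
  set g := cauchyTransform μ z with hg
  have hmg : m = z * g - 1 := psiTransform_inv μ hz.ne'
  have hid : cauchyTransform ρ z * (1 - c * m) = g := by
    have := (booleanK_eq_nat_mul_iff hz n).1 (h z hz)
    rw [hmg, hcdef]; push_cast; linear_combination this
  have hkre : ∀ t : ℝ, (psiKernel t z⁻¹).re = t * (z.re - t) / ((z.re - t) ^ 2 + z.im ^ 2) := by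
    intro t
    have : psiKernel t z⁻¹ = t * (1 / (z - t)) := by
      rw [psiKernel_inv hz.ne']
      have := sub_ofReal_ne_zero hz.ne' t
      field_simp; ring
    rw [this, Complex.re_ofReal_mul, one_div, Complex.inv_re, Complex.normSq_apply]
    simp [sq, mul_div_assoc]
  have hkim : ∀ t : ℝ, (psiKernel t z⁻¹).im = t * (-z.im / ((z.re - t) ^ 2 + z.im ^ 2)) := by
    intro t
    have : psiKernel t z⁻¹ = t * (1 / (z - t)) := by
      rw [psiKernel_inv hz.ne']
      have := sub_ofReal_ne_zero hz.ne' t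
      field_simp; ring
    rw [this, Complex.im_ofReal_mul, im_inv_sub]
  have hint : Integrable (fun t : ℝ => psiKernel t z⁻¹) (μ : Measure ℝ) := by
    simp_rw [psiKernel_inv hz.ne']
    exact ((integrable_inv_sub _ hz.ne').const_mul z).sub (integrable_const _)
  have hden : ∀ t : ℝ, 0 ≤ t → b ^ 2 ≤ (z.re - t) ^ 2 + z.im ^ 2 := by
    intro t ht; nlinarith [sq_nonneg z.im]
  have hmre : m.re ≤ 0 := by
    have := integral_re hint
    simp only [RCLike.re_to_complex] at this
    rw [hm, psiTransform, ← this]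
    refine integral_nonpos_of_ae ?_
    filter_upwards [hμ.ae_nonneg] with t ht
    rw [hkre]
    exact div_nonpos_of_nonpos_of_nonneg (by nlinarith) (by positivity)
  have hmim : |m.im| ≤ 1 / (-b) * z.im := by
    have := integral_im hint
    simp only [RCLike.im_to_complex] at this
    rw [hm, psiTransform, ← this, ← Real.norm_eq_abs]
    refine (norm_integral_le_of_norm_le_const (C := 1 / (-b) * z.im) ?_).trans (by simp)
    filter_upwards [hμ.ae_nonneg] with t ht
    have h1 := hden t ht
    rw [hkim, Real.norm_eq_abs, neg_div, mul_neg, abs_neg, abs_of_nonneg (by positivity),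
      ← mul_div_assoc, div_le_iff₀ (by linarith)]
    have h2 : t * (-b) ≤ (z.re - t) ^ 2 + z.im ^ 2 := by nlinarith [sq_nonneg z.im]
    have hnb : 0 < -b := by linarith
    rw [one_div, inv_mul_eq_div, div_mul_eq_mul_div, le_div_iff₀ hnb]
    nlinarith
  have hgim : |g.im| ≤ 1 / b ^ 2 * z.im := by
    rw [hg, im_cauchyTransform μ hz.ne', ← Real.norm_eq_abs]
    refine (norm_integral_le_of_norm_le_const (C := 1 / b ^ 2 * z.im) ?_).trans (by simp)
    filter_upwards [hμ.ae_nonneg] with t ht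
    have h1 := hden t ht
    rw [Real.norm_eq_abs, neg_div, abs_neg, abs_of_nonneg (by positivity), one_div_mul_eq_div]
    gcongr
  have hgn : ‖g‖ ≤ 1 / (-b) := by
    refine (norm_integral_le_of_norm_le_const (C := 1 / (-b)) ?_).trans (by simp)
    filter_upwards [hμ.ae_nonneg] with t ht
    rw [norm_div, norm_one]
    refine one_div_le_one_div_of_le (by linarith) ?_
    have := Complex.abs_re_le_norm (z - (t : ℂ))
    simp only [Complex.sub_re, Complex.ofReal_re] at this
    have h2 := neg_abs_le (z.re - t)
    linarith
  set D := 1 - (c : ℂ) * m with hD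
  have hDre : 1 ≤ D.re := by simp [hD]; nlinarith
  have hDim : |D.im| ≤ c * |m.im| := by simp [hD, abs_mul, abs_of_nonneg hc]
  have hDn : 1 ≤ Complex.normSq D := by
    rw [Complex.normSq_apply]; nlinarith [mul_self_nonneg D.im]
  have hD0 : D ≠ 0 := by intro h0; rw [h0] at hDre; simp at hDre; linarith
  rw [eq_div_of_mul_eq hD0 hid]
  have hfin : -(g / D).im = (g.re * D.im - g.im * D.re) / Complex.normSq D := by
    rw [Complex.div_im]; ring
  have hDre2 : D.re ≤ Complex.normSq D := by
    rw [Complex.normSq_apply]; nlinarith [mul_self_nonneg D.im]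
  rw [hfin, div_le_iff₀ (by linarith)]
  have e1 : g.re * D.im ≤ 1 / (-b) * (c * (1 / (-b) * z.im)) := by
    calc g.re * D.im ≤ |g.re| * |D.im| := by rw [← abs_mul]; exact le_abs_self _
      _ ≤ _ := by
        refine mul_le_mul ((Complex.abs_re_le_norm g).trans hgn) (hDim.trans ?_) (abs_nonneg _) ?_
        · gcongr
        · exact (norm_nonneg g).trans hgn
  have e2 : -(g.im * D.re) ≤ 1 / b ^ 2 * z.im * Complex.normSq D := by
    calc -(g.im * D.re) ≤ |g.im| * D.re := by nlinarith [neg_abs_le g.im]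
      _ ≤ _ := by gcongr
  have e3 : 1 / (-b) * (c * (1 / (-b) * z.im)) = c / b ^ 2 * z.im := by
    field_simp
  have e4 : 0 ≤ c / b ^ 2 * z.im := by positivity
  have e5 : (n : ℝ) / b ^ 2 * z.im = 1 / b ^ 2 * z.im + c / b ^ 2 * z.im := by
    rw [hcdef]; ring
  rw [e5]
  nlinarith

/-- The Cauchy transform of `ρ` is nearly real close to the negative half-line, so intervals of
length `h` there have `ρ`-mass `O(h ^ 2)`; subdividing shows that the mass vanishes. -/
lemma supportedOnNonneg_of_booleanK {ρ : ProbabilityMeasure ℝ} {n : ℕ} (hn : 1 ≤ n)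
    (h : ∀ z : ℂ, 0 < z.im → booleanK ρ z = n * booleanK μ z) : SupportedOnNonneg ρ := by
  have hball : ∀ b x ε : ℝ, b < 0 → x ≤ b → 0 < ε →
      (ρ : Measure ℝ).real (Icc (x - ε) (x + ε)) ≤ 2 * n / b ^ 2 * ε ^ 2 := by
    intro b x ε hb hx hε
    set z : ℂ := ⟨x, ε⟩ with hz
    have h1 := neg_im_cauchyTransform_le hμ hn h hb (z := z) hε hx
    rw [im_cauchyTransform ρ (z := z) hε.ne', ← integral_neg] at h1
    have h2 : (ρ : Measure ℝ).real (Icc (x - ε) (x + ε)) * (1 / (2 * ε)) ≤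
        ∫ t, -(-z.im / ((z.re - t) ^ 2 + z.im ^ 2)) ∂(ρ : Measure ℝ) := by
      rw [← smul_eq_mul, ← integral_indicator_const _ measurableSet_Icc]
      refine integral_mono ((integrable_const _).indicator measurableSet_Icc)
        (integrable_poisson (ρ : Measure ℝ) (z := z) hε.ne').neg fun t => ?_
      have hp : 0 < (x - t) ^ 2 + ε ^ 2 := by positivity
      simp only [hz, neg_div, neg_neg]
      by_cases ht : t ∈ Icc (x - ε) (x + ε)
      · rw [indicator_of_mem ht, div_le_div_iff₀ (by positivity) hp]
        nlinarith [ht.1, ht.2]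
      · rw [indicator_of_notMem ht]; positivity
    have h3 := h2.trans h1
    simp only [hz] at h3
    rw [mul_one_div, div_le_iff₀ (by positivity)] at h3
    calc _ ≤ _ := h3
      _ = _ := by ring
  have hIco : ∀ a b : ℝ, a < b → b < 0 → (ρ : Measure ℝ) (Ico a b) = 0 := by
    intro a b hab hb
    have hbound : ∀ N : ℕ, (ρ : Measure ℝ).real (Ico a b)
        ≤ (n * (b - a) ^ 2 / (2 * b ^ 2)) / ((N : ℝ) + 1) := by
      intro N
      set d : ℝ := (b - a) / (N + 1) with hd
      have hN : (0 : ℝ) < N + 1 := by positivity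
      have hd0 : 0 < d := div_pos (by linarith) hN
      have hNd : (N + 1) * d = b - a := by rw [hd]; field_simp
      have hsub : Ico a b ⊆ ⋃ i ∈ Finset.range (N + 1),
          Icc ((a + (i + 1 / 2) * d) - d / 2) ((a + (i + 1 / 2) * d) + d / 2) := by
        intro t ht
        have ht0 : 0 ≤ (t - a) / d := div_nonneg (by linarith [ht.1]) hd0.le
        have h1 := Nat.floor_le ht0
        have h2 := Nat.lt_floor_add_one ((t - a) / d)
        rw [le_div_iff₀ hd0] at h1
        rw [div_lt_iff₀ hd0] at h2
        have h3 : ⌊(t - a) / d⌋₊ < N + 1 := by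
          rw [Nat.floor_lt ht0, div_lt_iff₀ hd0]; push_cast; rw [hNd]; linarith [ht.2]
        simp only [mem_iUnion]
        exact ⟨_, Finset.mem_range.2 h3, by linarith, by linarith⟩
      have hle : ∀ i ∈ Finset.range (N + 1), (ρ : Measure ℝ).real
          (Icc ((a + ((i : ℝ) + 1 / 2) * d) - d / 2) ((a + (i + 1 / 2) * d) + d / 2))
          ≤ 2 * n / b ^ 2 * (d / 2) ^ 2 := by
        intro i hi
        refine hball b _ _ hb ?_ (by positivity)
        have : (i : ℝ) + 1 ≤ N + 1 := by
          have := Finset.mem_range.1 hi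
          exact_mod_cast this
        nlinarith
      calc _ ≤ _ := measureReal_mono hsub (measure_ne_top _ _)
        _ ≤ _ := measureReal_biUnion_finset_le _ _
        _ ≤ _ := Finset.sum_le_sum hle
        _ = _ := by
          rw [Finset.sum_const, Finset.card_range, nsmul_eq_mul, hd]; push_cast; field_simp
    have hlim := tendsto_const_div_atTop_nhds_zero_nat (n * (b - a) ^ 2 / (2 * b ^ 2))
    have hlim' := (tendsto_add_atTop_iff_nat 1).2 hlim
    have : (ρ : Measure ℝ).real (Ico a b) ≤ 0 :=
      ge_of_tendsto' hlim' fun N => by have := hbound N; push_cast; exact this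
    exact (measureReal_eq_zero_iff (measure_ne_top _ _)).1 (le_antisymm this measureReal_nonneg)
  have hcov : Iio (0 : ℝ) ⊆ ⋃ k : ℕ, Ico (-((k : ℝ) + 2)) (-(1 / ((k : ℝ) + 1))) := by
    intro t ht
    have ht' : 0 < -t := neg_pos.2 ht
    obtain ⟨k, hk⟩ := exists_nat_gt (max (-t) (1 / (-t)))
    have h1 := (le_max_left _ _).trans_lt hk
    have h2 := (le_max_right _ _).trans_lt hk
    refine mem_iUnion.2 ⟨k, by linarith, ?_⟩
    have : 1 / ((k : ℝ) + 1) < -t := by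
      rw [div_lt_comm₀ (by positivity) ht']; linarith
    linarith
  refine measure_mono_null hcov (measure_iUnion_null fun k => hIco _ _ ?_ ?_)
  · have : 1 / ((k : ℝ) + 1) ≤ 1 := by
      rw [div_le_one (by positivity)]; linarith [Nat.cast_nonneg (α := ℝ) k]
    linarith [Nat.cast_nonneg (α := ℝ) k]
  · have : 0 < 1 / ((k : ℝ) + 1) := by positivity
    linarith

end

/-! ### Spectral measures of bounded self-adjoint operators -/

section
variable {H : Type*} [NormedAddCommGroup H] [InnerProductSpace ℂ H] [CompleteSpace H]

/-- The positive functional `f ↦ ⟨e, f(J) e⟩` on functions on the spectrum of `J`. -/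
noncomputable def spectralFunctional {J : H →L[ℂ] H} (hJ : IsSelfAdjoint J) (e : H) :
    CompactlySupportedContinuousMap (spectrum ℝ J) ℝ →ₚ[ℝ] ℝ :=
  PositiveLinearMap.mk₀
    { toFun := fun f => (inner ℂ e (cfcHom hJ f.toContinuousMap e)).re
      map_add' := fun f g => by
        have : (f + g).toContinuousMap = f.toContinuousMap + g.toContinuousMap := rfl
        rw [this, map_add]; simp
      map_smul' := fun c f => by
        have : (c • f).toContinuousMap = c • f.toContinuousMap := rfl
        rw [this, map_smul]
        simp [inner_smul_right_eq_smul] }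
    (fun f hf => by
      have h0 : 0 ≤ f.toContinuousMap := fun x => hf x
      have h1 : 0 ≤ cfcHom hJ f.toContinuousMap := (cfcHom_nonneg_iff hJ).2 h0
      exact ((ContinuousLinearMap.nonneg_iff_isPositive _).1 h1).re_inner_nonneg_right e)

lemma exists_spectralMeasure {J : H →L[ℂ] H} (hJ : IsSelfAdjoint J) {e : H} (he : ‖e‖ = 1) :
    ∃ ν : Measure (spectrum ℝ J), IsProbabilityMeasure ν ∧ ∀ f : C(spectrum ℝ J, ℝ),
      inner ℂ e (cfcHom hJ f e) = ((∫ x, f x ∂ν : ℝ) : ℂ) := by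
  have hcompact : CompactSpace (spectrum ℝ J) :=
    isCompact_iff_compactSpace.1 (spectrum.isCompact J)
  have key : ∀ f : C(spectrum ℝ J, ℝ), inner ℂ e (cfcHom hJ f e)
      = ((∫ x, f x ∂(RealRMK.rieszMeasure (spectralFunctional hJ e)) : ℝ) : ℂ) := by
    intro f
    have h1 := RealRMK.integral_rieszMeasure (spectralFunctional hJ e)
      (CompactlySupportedContinuousMap.continuousMapEquiv f)
    have h2 : ∫ x, f x ∂(RealRMK.rieszMeasure (spectralFunctional hJ e))
        = (inner ℂ e (cfcHom hJ f e)).re := h1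
    rw [h2]
    have hsa : IsSelfAdjoint (cfcHom hJ f) := (IsSelfAdjoint.all f).map (cfcHom hJ)
    have h3 : starRingEnd ℂ (inner ℂ e (cfcHom hJ f e)) = inner ℂ e (cfcHom hJ f e) := by
      rw [inner_conj_symm]
      exact ContinuousLinearMap.isSelfAdjoint_iff_isSymmetric.1 hsa e e
    exact (Complex.conj_eq_iff_re.1 h3).symm
  refine ⟨RealRMK.rieszMeasure (spectralFunctional hJ e), ⟨?_⟩, key⟩
  have h1 := key 1
  rw [map_one] at h1
  simp only [one_apply_eq_self, inner_self_eq_norm_sq_to_K, he] at h1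
  have h2 : (RealRMK.rieszMeasure (spectralFunctional hJ e)).real univ = 1 := by
    have : ((RealRMK.rieszMeasure (spectralFunctional hJ e)).real univ : ℂ) = 1 := by
      simpa using h1.symm
    exact_mod_cast this
  rw [measureReal_def] at h2
  exact (ENNReal.toReal_eq_one_iff _).1 h2

lemma mul_ofReal_sub_one_ne_zero {a : ℂ} (ha : a.im ≠ 0) (j : ℝ) : a * j - 1 ≠ 0 := by
  intro h
  have h1 := congrArg Complex.im h
  simp [ha] at h1
  rw [h1] at h; simp at h

/-- The matrix element of the resolvent of `J` in terms of the spectral measure. -/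
lemma exists_measure_integral_resolvent {J : H →L[ℂ] H} (hJ : IsSelfAdjoint J) {e : H}
    (he : ‖e‖ = 1) : ∃ ν : Measure ℝ, IsProbabilityMeasure ν ∧ ∀ a : ℂ, a.im ≠ 0 → ∀ x : H,
      a • J x - x = J e → ∫ j : ℝ, (j : ℂ) / (a * j - 1) ∂ν = inner ℂ e x := by
  obtain ⟨ν, hν, hcalc⟩ := exists_spectralMeasure hJ he
  have hcompact : CompactSpace (spectrum ℝ J) :=
    isCompact_iff_compactSpace.1 (spectrum.isCompact J)
  refine ⟨ν.map (↑), Measure.isProbabilityMeasure_map measurable_subtype_coe.aemeasurable, ?_⟩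
  intro a ha x hx
  set X : C(spectrum ℝ J, ℝ) := (ContinuousMap.id ℝ).restrict (spectrum ℝ J) with hX
  have hXJ : cfcHom hJ X = J := cfcHom_id hJ
  have hXv : ∀ j, X j = (j : ℝ) := fun _ => rfl
  have hns : ∀ j : ℝ, Complex.normSq (a * j - 1)
      = Complex.normSq a * j ^ 2 - 2 * a.re * j + 1 := by
    intro j
    simp [Complex.normSq_apply]; ring
  set g : C(spectrum ℝ J, ℝ) :=
    Complex.normSq a • (X * X) - (2 * a.re) • X + 1 with hg
  have hgv : ∀ j, g j = Complex.normSq (a * (j : ℝ) - 1) := by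
    intro j
    rw [hns]
    simp only [hg, ContinuousMap.add_apply, ContinuousMap.sub_apply, ContinuousMap.smul_apply,
      ContinuousMap.mul_apply, ContinuousMap.one_apply, hXv, smul_eq_mul]
    ring
  have hg0 : ∀ j, g j ≠ 0 := fun j => by
    rw [hgv]; exact (Complex.normSq_pos.2 (mul_ofReal_sub_one_ne_zero ha _)).ne'
  set r : C(spectrum ℝ J, ℝ) := ⟨fun j => (g j)⁻¹, g.continuous.inv₀ hg0⟩ with hr
  have hrg : r * g = 1 := by ext j; simp [hr, hg0 j]
  have hφ : cfcHom hJ r * cfcHom hJ g = 1 := by rw [← map_mul, hrg, map_one]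
  have hgJ : cfcHom hJ g = Complex.normSq a • (J * J) - (2 * a.re) • J + 1 := by
    rw [hg, map_add, map_sub, map_smul, map_smul, map_mul, map_one, hXJ]
  -- multiply `(a J - 1) x = J e` by `conj a J - 1`, then by the inverse of the real polynomial
  have hgx : cfcHom hJ g x = starRingEnd ℂ a • J (J e) - J e := by
    rw [hgJ, ← hx]
    simp only [add_apply, sub_apply, smul_apply, one_apply_eq_self, map_sub, map_smul]
    have h3 : (J * J) x = J (J x) := rfl
    have h1 : (Complex.normSq a) • J (J x) = (starRingEnd ℂ a * a) • J (J x) := by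
      rw [← Complex.normSq_eq_conj_mul_self]; rfl
    have h2 : (2 * a.re) • J x = (a + starRingEnd ℂ a) • J x := by
      rw [Complex.add_conj]; rfl
    rw [h3, h1, h2]; module
  have hxe : x = starRingEnd ℂ a • cfcHom hJ (r * (X * X)) e - cfcHom hJ (r * X) e := by
    have h1 : cfcHom hJ r (cfcHom hJ g x) = x := by
      change (cfcHom hJ r * cfcHom hJ g) x = x
      rw [hφ, one_apply_eq_self]
    rw [hgx, map_sub, map_smul] at h1
    rw [← h1, map_mul, map_mul, map_mul, hXJ]; rfl
  rw [hxe, inner_sub_right, inner_smul_right, hcalc, hcalc, integral_map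
    measurable_subtype_coe.aemeasurable (Measurable.aestronglyMeasurable (by fun_prop))]
  rw [← integral_complex_ofReal, ← integral_complex_ofReal, ← integral_const_mul, ← integral_sub]
  · refine integral_congr_ae (ae_of_all _ fun j => ?_)
    have h0 := mul_ofReal_sub_one_ne_zero ha j
    have h1 : ((r j : ℝ) : ℂ) = ((starRingEnd ℂ a * (j : ℝ) - 1) * (a * (j : ℝ) - 1))⁻¹ := by
      have : r j = (g j)⁻¹ := rfl
      rw [this, hgv, Complex.ofReal_inv, Complex.normSq_eq_conj_mul_self]; simp
    have h2 : starRingEnd ℂ a * (j : ℝ) - 1 ≠ 0 :=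
      mul_ofReal_sub_one_ne_zero (by simpa using ha) j
    simp only [ContinuousMap.mul_apply, hXv, Complex.ofReal_mul, h1, mul_inv, div_eq_mul_inv]
    linear_combination (-((j : ℝ) : ℂ) * (a * (j : ℝ) - 1)⁻¹) * mul_inv_cancel₀ h2
  · exact ((Continuous.integrable_of_hasCompactSupport (r * (X * X)).continuous
      (HasCompactSupport.of_compactSpace _)).ofReal).const_mul _
  · exact (Continuous.integrable_of_hasCompactSupport (r * X).continuous
      (HasCompactSupport.of_compactSpace _)).ofReal
end

/-! ### Existence of Boolean powers -/

section
variable {H : Type*} [NormedAddCommGroup H] [InnerProductSpace ℂ H] [CompleteSpace H]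

/-- Given `Q = (1 + T)⁻¹` for a self-adjoint `T` and a unit vector `e`, the operator
`J = S (Q + κ Q E Q) S`, with `E` the projection onto `e` and `S = 1 - (1 - σ) E`, plays the role
of `(1 + S⁻¹ T S⁻¹)⁻¹`; its resolvent vector at `e` is computed from `g = (z - T)⁻¹ e`,
`a = z + 1`. -/
lemma exists_isSelfAdjoint_resolvent {Q : H →L[ℂ] H} (hQ : IsSelfAdjoint Q) {e : H}
    (he : ‖e‖ = 1) {θ ν σ : ℝ} (hθ : inner ℂ e (Q e) = θ) (hσ : σ ^ 2 = 1 - ν)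
    (hνθ : 1 - ν * θ ≠ 0) :
    ∃ J : H →L[ℂ] H, IsSelfAdjoint J ∧ ∀ (a : ℂ) (g : H), a • Q g = Q e + g →
      1 - (a - 1) * ν * inner ℂ e g ≠ 0 → ∃ x, a • J x - x = J e ∧
        inner ℂ e x = σ ^ 2 * inner ℂ e g / (1 - (a - 1) * ν * inner ℂ e g) := by
  set E : H →L[ℂ] H := InnerProductSpace.rankOne ℂ e e with hE
  have hEsa : IsSelfAdjoint E :=
    ContinuousLinearMap.isSelfAdjoint_iff_isSymmetric.2
      (InnerProductSpace.isSymmetric_rankOne_self e)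
  have hEx : ∀ x, E x = inner ℂ e x • e := fun x => InnerProductSpace.rankOne_apply e e x
  have hee : inner ℂ e e = (1 : ℂ) := by rw [inner_self_eq_norm_sq_to_K, he]; simp
  set κ : ℝ := ν / (1 - ν * θ) with hκ
  set S : H →L[ℂ] H := 1 - ((1 - σ : ℝ) : ℂ) • E with hS
  have hreal : ∀ x : ℝ, IsSelfAdjoint (x : ℂ) := fun x => Complex.conj_ofReal x
  have hSsa : IsSelfAdjoint S := (IsSelfAdjoint.one _).sub (IsSelfAdjoint.smul (hreal _) hEsa)
  have hSx : ∀ x, S x = x - ((1 - σ : ℝ) : ℂ) • inner ℂ e x • e := by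
    intro x; rw [← hEx]; rfl
  set T : H →L[ℂ] H := Q + (κ : ℂ) • (Q * E * Q) with hT
  have hTsa : IsSelfAdjoint T := by
    refine hQ.add (IsSelfAdjoint.smul (hreal κ) ?_)
    have := hEsa.conjugate Q
    rwa [hQ.star_eq] at this
  have hTx : ∀ x, T x = Q x + (κ : ℂ) • inner ℂ e (Q x) • Q e := by
    intro x
    rw [← map_smul, ← hEx]; rfl
  refine ⟨S * T * S, ?_, ?_⟩
  · have := hTsa.conjugate S
    rwa [hSsa.star_eq] at this
  intro a g hg hne
  set G : ℂ := inner ℂ e g with hG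
  set β : ℂ := σ / (1 - (a - 1) * ν * G) with hβ
  have hβ' : β * (1 - (a - 1) * ν * G) = σ := div_mul_cancel₀ _ hne
  have hκ' : (κ : ℂ) * (1 - ν * θ) = ν := by
    have : κ * (1 - ν * θ) = ν := div_mul_cancel₀ _ hνθ
    exact_mod_cast this
  have hνθ' : (1 : ℂ) - ν * θ ≠ 0 := by exact_mod_cast hνθ
  have hσ' : (σ : ℂ) ^ 2 = 1 - ν := by exact_mod_cast congrArg (fun x : ℝ => (x : ℂ)) hσ
  have hSe : S e = (σ : ℂ) • e := by
    rw [hSx, hee]; push_cast; module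
  have hSg : S g = g - ((1 - σ : ℝ) : ℂ) • G • e := hSx g
  have hSSg : S (S g) = g - (ν * G : ℂ) • e := by
    rw [hSg, map_sub, map_smul, map_smul, hSe, hSg]
    push_cast
    have : (ν : ℂ) = 1 - σ ^ 2 := by rw [hσ']; ring
    rw [this]; module
  have hTe : T e = (1 + κ * θ : ℂ) • Q e := by rw [hTx, hθ]; module
  have hTg : a • T g = Q e + g + (κ * (θ + G) : ℂ) • Q e := by
    have h1 : a * inner ℂ e (Q g) = θ + G := by
      rw [← inner_smul_right, hg, inner_add_right, hθ]
    rw [hTx, smul_add, hg, ← h1]; module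
  refine ⟨β • S g, ?_, ?_⟩
  · change a • S (T (S (β • S g))) - β • S g = S (T (S e))
    have h1 : a • T (S (β • S g)) - β • g = T (S e) := by
      have h2 : a • T (S (β • S g)) = β • (a • T g - (a * (ν * G)) • T e) := by
        rw [map_smul, map_smul, hSSg, map_sub, map_smul]; module
      rw [h2, hTg, hSe, map_smul, hTe]
      have hcoef : β * (1 + κ * (θ + G) - a * (ν * G) * (1 + κ * θ)) = σ * (1 + κ * θ) := by
        apply mul_left_cancel₀ hνθ'
        linear_combination hβ' + (β * (θ + G - a * ν * G * θ) - σ * θ) * hκ'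
      calc _ = (β * (1 + κ * (θ + G) - a * (ν * G) * (1 + κ * θ))) • Q e := by module
        _ = _ := by rw [hcoef]; module
    rw [← h1]; simp only [map_sub, map_smul]
  · rw [inner_smul_right, hSg, inner_sub_right, inner_smul_right, inner_smul_right, hee, ← hG, hβ]
    push_cast; field_simp; ring
end

section
variable (μ : ProbabilityMeasure ℝ)

lemma memLp_of_norm_le (μ : Measure ℝ) [IsFiniteMeasure μ] {f : ℝ → ℂ} (hf : Measurable f) {C : ℝ}
    (hC : ∀ t, ‖f t‖ ≤ C) (p : ENNReal) : MemLp f p μ :=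
  MemLp.of_bound hf.aestronglyMeasurable C (ae_of_all _ hC)

/-- Multiplication by a bounded function, as an operator on `L²(μ)`. -/
lemma exists_mulOperator (μ : Measure ℝ) [IsFiniteMeasure μ] {q : ℝ → ℝ} (hq : Measurable q)
    {C : ℝ} (hC : ∀ t, ‖(q t : ℂ)‖ ≤ C) :
    ∃ Q : Lp ℂ 2 μ →L[ℂ] Lp ℂ 2 μ, IsSelfAdjoint Q ∧ ∀ h, Q h =ᵐ[μ] fun t => q t * h t := by
  have hqm : MemLp (fun t => (q t : ℂ)) ⊤ μ := memLp_of_norm_le μ (by fun_prop) hC ⊤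
  have hQ : ∀ h, (ContinuousLinearMap.mul ℂ ℂ).holderL μ ⊤ 2 2 (hqm.toLp _) h
      =ᵐ[μ] fun t => q t * h t := by
    intro h
    filter_upwards [(ContinuousLinearMap.mul ℂ ℂ).coeFn_holder (r := 2) (hqm.toLp _) h,
      hqm.coeFn_toLp] with t h1 h2
    rw [ContinuousLinearMap.holderL_apply_apply, h1, h2]; rfl
  refine ⟨_, ?_, hQ⟩
  refine ContinuousLinearMap.isSelfAdjoint_iff_isSymmetric.2 fun f h => ?_
  rw [L2.inner_def, L2.inner_def]
  refine integral_congr_ae ?_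
  filter_upwards [hQ f, hQ h] with t h1 h2
  simp only [ContinuousLinearMap.coe_coe, h1, h2, RCLike.inner_apply, map_mul, Complex.conj_ofReal]
  ring

/-- `z (z G_μ(z) - 1)` has nonpositive imaginary part, hence `z G_μ(z) - 1` is never a positive
number. -/
lemma nat_sub_mul_cauchyTransform_ne_zero {z : ℂ} (hz : 0 < z.im) {n : ℕ} (hn : 1 ≤ n) :
    (n : ℂ) - (n - 1) * z * cauchyTransform μ z ≠ 0 := by
  intro h
  set m := psiTransform (μ : Measure ℝ) z⁻¹ with hm
  have hmg : m = z * cauchyTransform μ z - 1 := psiTransform_inv μ hz.ne'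
  have hc : (0 : ℝ) ≤ n - 1 := by
    have : (1 : ℝ) ≤ n := by exact_mod_cast hn
    linarith
  have h1 : ((n - 1 : ℝ) : ℂ) * (z * m) = z := by
    rw [hmg]; push_cast; linear_combination -z * h
  have h2 : (z * m).im ≤ 0 := by
    have hint : Integrable (fun t : ℝ => z * psiKernel t z⁻¹) (μ : Measure ℝ) := by
      simp_rw [psiKernel_inv hz.ne']
      exact (((integrable_inv_sub _ hz.ne').const_mul z).sub (integrable_const _)).const_mul z
    have := integral_im hint
    simp only [RCLike.im_to_complex] at this
    rw [hm, psiTransform, ← integral_const_mul, ← this]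
    refine integral_nonpos fun t => ?_
    have h3 : z * psiKernel t z⁻¹ = (t : ℂ) + ((t ^ 2 : ℝ) : ℂ) * (1 / (z - t)) := by
      rw [psiKernel_inv hz.ne']
      have := sub_ofReal_ne_zero hz.ne' t
      push_cast; field_simp; ring
    simp only [Pi.zero_apply]
    rw [h3, Complex.add_im, Complex.im_ofReal_mul, im_inv_sub, Complex.ofReal_im, zero_add, neg_div]
    have : 0 ≤ t ^ 2 * (z.im / ((z.re - t) ^ 2 + z.im ^ 2)) := by positivity
    linarith
  have h4 := congrArg Complex.im h1
  rw [Complex.im_ofReal_mul] at h4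
  nlinarith

/-- The Boolean power in the variable `j = 1 / (1 + t)`, for which `1 / (z - t)` becomes
`j / ((z + 1) j - 1)`; mass at `j = 0`, that is at `t = ∞`, is not excluded here. -/
lemma exists_measure_integral_eq_cauchyTransform (hμ : SupportedOnNonneg μ) {n : ℕ} (hn : 1 ≤ n) :
    ∃ ν : Measure ℝ, IsProbabilityMeasure ν ∧ ∀ z : ℂ, 0 < z.im →
      ∫ j : ℝ, (j : ℂ) / ((z + 1) * j - 1) ∂ν
        = cauchyTransform μ z / (n - (n - 1) * z * cauchyTransform μ z) := by
  have hn0 : (0 : ℝ) < n := by exact_mod_cast hn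
  have hn1 : (1 : ℝ) ≤ n := by exact_mod_cast hn
  set q : ℝ → ℝ := fun t => 1 / (1 + |t|) with hq
  have hq01 : ∀ t, 0 < q t ∧ q t ≤ 1 := by
    intro t
    have : 0 ≤ |t| := abs_nonneg t
    exact ⟨by positivity, by rw [hq]; exact (div_le_one (by positivity)).2 (by linarith)⟩
  have hqm : Measurable q := by fun_prop
  have hqn : ∀ t, ‖(q t : ℂ)‖ ≤ 1 := fun t => by
    rw [Complex.norm_real, Real.norm_eq_abs, abs_of_pos (hq01 t).1]; exact (hq01 t).2
  obtain ⟨Q, hQ, hQv⟩ := exists_mulOperator (μ : Measure ℝ) hqm hqn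
  have h1m : MemLp (fun _ : ℝ => (1 : ℂ)) 2 (μ : Measure ℝ) := memLp_const 1
  set e : Lp ℂ 2 (μ : Measure ℝ) := h1m.toLp _ with he
  have hev : e =ᵐ[(μ : Measure ℝ)] fun _ => (1 : ℂ) := h1m.coeFn_toLp
  have hinner : ∀ h : Lp ℂ 2 (μ : Measure ℝ), inner ℂ e h = ∫ t, h t ∂(μ : Measure ℝ) := by
    intro h
    rw [L2.inner_def]
    refine integral_congr_ae ?_
    filter_upwards [hev] with t ht
    rw [ht]; simp
  have hee : inner ℂ e e = (1 : ℂ) := by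
    rw [hinner, integral_congr_ae hev]; simp
  have hen : ‖e‖ = 1 := by
    have := inner_self_eq_norm_sq (𝕜 := ℂ) e
    rw [hee] at this
    exact (pow_eq_one_iff_of_nonneg (norm_nonneg e) two_ne_zero).1 (by simpa using this.symm)
  set θ : ℝ := ∫ t, q t ∂(μ : Measure ℝ) with hθ
  have hQe : Q e =ᵐ[(μ : Measure ℝ)] fun t => (q t : ℂ) := by
    filter_upwards [hQv e, hev] with t h1 h2
    rw [h1, h2, mul_one]
  have hθe : inner ℂ e (Q e) = θ := by
    rw [hinner, integral_congr_ae hQe, hθ, integral_complex_ofReal]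
  have hθ1 : θ ≤ 1 := by
    have hi : Integrable q (μ : Measure ℝ) := Integrable.of_bound hqm.aestronglyMeasurable 1
      (ae_of_all _ fun t => by rw [Real.norm_eq_abs, abs_of_pos (hq01 t).1]; exact (hq01 t).2)
    have := integral_mono hi (integrable_const (1 : ℝ)) fun t => (hq01 t).2
    simpa using this
  set ν : ℝ := (n - 1) / n with hν
  have hν1 : 1 - ν = 1 / n := by rw [hν]; field_simp; ring
  have hν0 : 0 ≤ ν := div_nonneg (by linarith) hn0.le
  have hνθ : 1 - ν * θ ≠ 0 := by
    have h3 : (0 : ℝ) < 1 / n := by positivity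
    nlinarith
  obtain ⟨J, hJ, hres⟩ := exists_isSelfAdjoint_resolvent hQ hen hθe (σ := √(1 / n)) (ν := ν)
    (by rw [Real.sq_sqrt (by positivity), hν1]) hνθ
  obtain ⟨lam, hlam, hint⟩ := exists_measure_integral_resolvent hJ hen
  refine ⟨lam, hlam, fun z hz => ?_⟩
  have hgm : MemLp (fun t : ℝ => 1 / (z - (t : ℂ))) 2 (μ : Measure ℝ) :=
    memLp_of_norm_le _ (by fun_prop) (norm_inv_sub_ofReal_le hz.ne') 2
  set g : Lp ℂ 2 (μ : Measure ℝ) := hgm.toLp _ with hg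
  have hgv : g =ᵐ[(μ : Measure ℝ)] fun t => 1 / (z - (t : ℂ)) := hgm.coeFn_toLp
  have hG : inner ℂ e g = cauchyTransform μ z := by
    rw [hinner, integral_congr_ae hgv, cauchyTransform]
  have hQg : (z + 1) • Q g = Q e + g := by
    refine Lp.ext ?_
    filter_upwards [Lp.coeFn_smul (z + 1) (Q g), Lp.coeFn_add (Q e) g, hQv g, hQe, hgv,
      hμ.ae_nonneg] with t h1 h2 h3 h4 h5 h6
    rw [h1, h2, Pi.smul_apply, Pi.add_apply, h3, h4, h5, smul_eq_mul]
    simp only [hq, abs_of_nonneg h6]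
    have h7 := sub_ofReal_ne_zero hz.ne' t
    have h8 : (1 : ℂ) + t ≠ 0 := by
      have : (1 : ℝ) + t ≠ 0 := by positivity
      exact_mod_cast this
    push_cast; field_simp; ring
  have hden := nat_sub_mul_cauchyTransform_ne_zero μ hz hn
  have hnC : (n : ℂ) ≠ 0 := by exact_mod_cast hn0.ne'
  have hden2 : 1 - (z + 1 - 1) * (ν : ℂ) * inner ℂ e g
      = (n - (n - 1) * z * cauchyTransform μ z) / n := by
    rw [hG, hν]; push_cast; field_simp; ring
  have hden3 : 1 - (z + 1 - 1) * (ν : ℂ) * inner ℂ e g ≠ 0 := by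
    rw [hden2]; exact div_ne_zero hden hnC
  obtain ⟨x, hx1, hx2⟩ := hres (z + 1) g hQg hden3
  rw [hint (z + 1) (by simpa using hz.ne') x hx1, hx2, hden2, hG]
  have hs : ((√(1 / n : ℝ) : ℝ) : ℂ) ^ 2 = 1 / n := by
    rw [← Complex.ofReal_pow, Real.sq_sqrt (by positivity)]; push_cast; rfl
  rw [hs]; field_simp

lemma tendsto_mul_cauchyTransform :
    Tendsto (fun y : ℝ => (y * Complex.I) * cauchyTransform μ (y * Complex.I - 1)) atTop (𝓝 1) := by
  simp only [cauchyTransform, ← integral_const_mul]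
  rw [show 𝓝 (1 : ℂ) = 𝓝 (∫ _, (1 : ℂ) ∂(μ : Measure ℝ)) by simp]
  refine tendsto_integral_filter_of_dominated_convergence (fun _ => (1 : ℝ))
    (Eventually.of_forall fun y => Measurable.aestronglyMeasurable (by fun_prop)) ?_
    (integrable_const _) ?_
  · filter_upwards [eventually_gt_atTop 0] with y hy
    refine ae_of_all _ fun t => ?_
    have := norm_inv_sub_ofReal_le (z := y * Complex.I - 1) (by simp [hy.ne']) t
    rw [norm_mul, norm_mul, Complex.norm_I, mul_one, Complex.norm_real, Real.norm_eq_abs,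
      abs_of_pos hy]
    have h3 : |((y : ℂ) * Complex.I - 1).im| = y := by simp [abs_of_pos hy]
    rw [h3] at this
    calc _ ≤ y * (1 / y) := by gcongr
      _ = 1 := by field_simp
  · refine ae_of_all _ fun t => ?_
    have h2 : Tendsto (fun y : ℝ => (1 : ℂ) + (1 + t) * Complex.I * ((y⁻¹ : ℝ) : ℂ)) atTop
        (𝓝 (1 + (1 + t) * Complex.I * ((0 : ℝ) : ℂ))) :=
      ((Complex.continuous_ofReal.tendsto 0).comp tendsto_inv_atTop_zero).const_mul _ |>.const_add _
    have h3 := h2.inv₀ (by simp)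
    simp only [Complex.ofReal_zero, mul_zero, add_zero, inv_one] at h3
    refine h3.congr' ?_
    filter_upwards [eventually_gt_atTop 0] with y hy
    have hyC : (y : ℂ) ≠ 0 := by exact_mod_cast hy.ne'
    have h4 := sub_ofReal_ne_zero (z := y * Complex.I - 1) (by simp [hy.ne']) t
    have h5 : (1 : ℂ) + (1 + t) * Complex.I * ((y⁻¹ : ℝ) : ℂ)
        = (y * Complex.I - 1 - t) / (y * Complex.I) := by
      push_cast; field_simp
      linear_combination (1 + (t : ℂ)) * Complex.I_sq
    rw [h5, inv_div]; ring

theorem exists_booleanK_eq_nat_mul (hμ : SupportedOnNonneg μ) {n : ℕ} (hn : 1 ≤ n) :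
    ∃ ρ : ProbabilityMeasure ℝ, ∀ z : ℂ, 0 < z.im → booleanK ρ z = n * booleanK μ z := by
  obtain ⟨ν, hν, hint⟩ := exists_measure_integral_eq_cauchyTransform μ hμ hn
  -- the point `j = 0`, which corresponds to `t = ∞`, carries no mass
  have hatom : ν {0} = 0 := by
    have hbd : ∀ y j : ℝ, ‖(1 : ℂ) / (1 - y * Complex.I * j)‖ ≤ 1 := by
      intro y j
      have h1 : (1 : ℝ) ≤ ‖(1 : ℂ) - y * Complex.I * j‖ := by
        have := Complex.abs_re_le_norm ((1 : ℂ) - y * Complex.I * j)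
        simpa using this
      rw [norm_div, norm_one]
      exact (div_le_one (by linarith)).2 h1
    have hm : ∀ y : ℝ, AEStronglyMeasurable (fun j : ℝ => (1 : ℂ) / (1 - y * Complex.I * j)) ν :=
      fun y => Measurable.aestronglyMeasurable (by fun_prop)
    have hlim1 : Tendsto (fun y : ℝ => ∫ j : ℝ, (1 : ℂ) / (1 - y * Complex.I * j) ∂ν) atTop
        (𝓝 (∫ j, ({0} : Set ℝ).indicator (fun _ => (1 : ℂ)) j ∂ν)) := by
      refine tendsto_integral_filter_of_dominated_convergence (fun _ => (1 : ℝ))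
        (Eventually.of_forall hm) (Eventually.of_forall fun y => ae_of_all _ (hbd y))
        (integrable_const _) (ae_of_all _ fun j => ?_)
      by_cases hj : j = 0
      · simp [hj]
      · rw [indicator_of_notMem (by simpa using hj)]
        refine squeeze_zero_norm' (a := fun y : ℝ => |j|⁻¹ * y⁻¹) ?_
          (by simpa using tendsto_inv_atTop_zero.const_mul (|j|⁻¹))
        filter_upwards [eventually_gt_atTop 0] with y hy
        have h1 : y * |j| ≤ ‖(1 : ℂ) - y * Complex.I * j‖ := by
          have := Complex.abs_im_le_norm ((1 : ℂ) - y * Complex.I * j)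
          simpa [abs_mul, abs_of_pos hy] using this
        have hj' : 0 < |j| := abs_pos.2 hj
        rw [norm_div, norm_one, ← mul_inv, mul_comm |j| y, ← one_div]
        exact one_div_le_one_div_of_le (by positivity) h1
    have hlim2 : Tendsto (fun y : ℝ => ∫ j : ℝ, (1 : ℂ) / (1 - y * Complex.I * j) ∂ν) atTop
        (𝓝 0) := by
      have hA := tendsto_mul_cauchyTransform μ
      have hinv : Tendsto (fun y : ℝ => ((y⁻¹ : ℝ) : ℂ) * (1 / Complex.I)) atTop (𝓝 0) := by
        simpa using ((Complex.continuous_ofReal.tendsto 0).comp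
          tendsto_inv_atTop_zero).mul_const (1 / Complex.I)
      have hG : Tendsto (fun y : ℝ => cauchyTransform μ (y * Complex.I - 1)) atTop (𝓝 0) := by
        have := hinv.mul hA
        rw [zero_mul] at this
        refine this.congr' ?_
        filter_upwards [eventually_gt_atTop 0] with y hy
        have hyC : (y : ℂ) ≠ 0 := by exact_mod_cast hy.ne'
        push_cast; field_simp
      have hden : Tendsto (fun y : ℝ => (n : ℂ) - (n - 1) *
          ((y * Complex.I) * cauchyTransform μ (y * Complex.I - 1)
            - cauchyTransform μ (y * Complex.I - 1))) atTop (𝓝 (n - (n - 1) * (1 - 0))) :=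
        ((hA.sub hG).const_mul _).const_sub _
      have hfin := (hA.div hden (by simp)).const_sub 1
      have h0 : (1 : ℂ) - 1 / (n - (n - 1) * (1 - 0)) = 0 := by
        rw [sub_zero, mul_one, sub_sub_cancel, div_one, sub_self]
      rw [h0] at hfin
      refine hfin.congr' ?_
      filter_upwards [eventually_gt_atTop 0] with y hy
      set z : ℂ := y * Complex.I - 1 with hz
      have hzim : 0 < z.im := by simp [hz, hy]
      have hz1 : z + 1 = y * Complex.I := by rw [hz]; ring
      have h2 := hint z hzim
      have hne : ∀ j : ℝ, (z + 1) * j - 1 ≠ 0 :=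
        mul_ofReal_sub_one_ne_zero (by simpa using hzim.ne')
      have h3 : ∫ j : ℝ, (1 : ℂ) / (1 - y * Complex.I * j) ∂ν
          = ∫ j : ℝ, (1 - (z + 1) * ((j : ℂ) / ((z + 1) * j - 1))) ∂ν := by
        refine integral_congr_ae (ae_of_all _ fun j => ?_)
        have h4 := hne j
        have h5 : 1 - (z + 1) * (j : ℂ) ≠ 0 := by
          intro h; apply h4; linear_combination -h
        simp only [← hz1]
        rw [div_eq_iff h5]
        have h6 := mul_inv_cancel₀ h4
        rw [div_eq_mul_inv]
        linear_combination -((z + 1) * (j : ℂ)) * h6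
      have hi : Integrable (fun j : ℝ => (z + 1) * ((j : ℂ) / ((z + 1) * j - 1))) ν := by
        have : (fun j : ℝ => (z + 1) * ((j : ℂ) / ((z + 1) * j - 1)))
            = fun j : ℝ => 1 - (1 : ℂ) / (1 - y * Complex.I * j) := by
          funext j
          have h4 := hne j
          have h5 : 1 - (z + 1) * (j : ℂ) ≠ 0 := by
            intro h; apply h4; linear_combination -h
          rw [← hz1, eq_sub_iff_add_eq, ← eq_sub_iff_add_eq', div_eq_iff h5]
          have h6 := mul_inv_cancel₀ h4
          rw [div_eq_mul_inv (j : ℂ)]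
          linear_combination -((z + 1) * (j : ℂ)) * h6
        rw [this]
        exact (integrable_const _).sub (Integrable.of_bound (hm y) 1 (ae_of_all _ (hbd y)))
      rw [h3, integral_sub (integrable_const _) hi, integral_const_mul, h2, hz1]
      change 1 - (y * Complex.I) * cauchyTransform μ z / (n - (n - 1) *
        ((y * Complex.I) * cauchyTransform μ z - cauchyTransform μ z)) = _
      rw [mul_div_assoc, ← hz1]
      simp only [integral_const, probReal_univ, one_smul]
      congr 4
      ring
    have h1 := tendsto_nhds_unique hlim1 hlim2
    rw [integral_indicator_const _ (measurableSet_singleton 0)] at h1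
    simp only [Complex.real_smul, mul_one, Complex.ofReal_eq_zero] at h1
    exact (measureReal_eq_zero_iff (measure_ne_top _ _)).1 h1
  have hm : Measurable (fun j : ℝ => 1 / j - 1) := by fun_prop
  have hprob : IsProbabilityMeasure (ν.map fun j : ℝ => 1 / j - 1) :=
    Measure.isProbabilityMeasure_map hm.aemeasurable
  obtain ⟨ρ, hρ⟩ : ∃ ρ : ProbabilityMeasure ℝ, (ρ : Measure ℝ) = ν.map fun j : ℝ => 1 / j - 1 :=
    ⟨⟨_, hprob⟩, rfl⟩
  refine ⟨ρ, fun z hz => ?_⟩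
  rw [booleanK_eq_nat_mul_iff hz n]
  have hG : cauchyTransform ρ z
      = cauchyTransform μ z / (n - (n - 1) * z * cauchyTransform μ z) := by
    rw [← hint z hz, cauchyTransform, hρ, integral_map hm.aemeasurable (Measurable.aestronglyMeasurable (by fun_prop))]
    refine integral_congr_ae ?_
    have hae : ∀ᵐ j ∂ν, j ≠ 0 := by rw [ae_iff]; simpa using hatom
    filter_upwards [hae] with j hj
    have hjC : (j : ℂ) ≠ 0 := by exact_mod_cast hj
    have h1 : z - ((1 / j - 1 : ℝ) : ℂ) = ((z + 1) * j - 1) / j := by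
      push_cast; field_simp; ring
    rw [h1, one_div_div]
  rw [hG, div_mul_cancel₀ _ (nat_sub_mul_cauchyTransform_ne_zero μ hz hn)]

end

theorem exists_isBooleanPower {μ : ProbabilityMeasure ℝ} (hμ : SupportedOnNonneg μ) {n : ℕ}
    (hn : 1 ≤ n) : ∃ ρ, IsBooleanPower μ n ρ := by
  induction n, hn using Nat.le_induction with
  | base => exact ⟨μ, .one⟩
  | succ n hn ih =>
    obtain ⟨σ, hσ⟩ := ih
    obtain ⟨ρ, hρ⟩ := exists_booleanK_eq_nat_mul μ hμ (n := n + 1) (by omega)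
    refine ⟨ρ, hσ.succ fun z hz => ?_⟩
    rw [hρ z hz, hσ.booleanK_eq z hz]; push_cast; ring

/-! ### Boolean-subexponentiality -/

theorem theorem2p3 (μ : ProbabilityMeasure ℝ) (hμ : SupportedOnNonneg μ)
    (α : ℝ) (hα : 0 ≤ α) (hreg : RegularlyVarying (measureTail μ) (-α)) :
    BooleanSubexponential μ := by
  refine ⟨hμ, fun y _ => measureTail_pos hreg y, fun n hn =>
    ⟨exists_isBooleanPower hμ hn, fun ρ hρ => ?_⟩⟩
  have hK := hρ.booleanK_eq
  exact isEquivalent_measureTail hμ (supportedOnNonneg_of_booleanK hμ hn hK) hreg hn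
    (psiTransform_eq_of_booleanK hK)
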